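/- An instance of the 3-Compatible colouring problem is a complete undirected graph $G=(V,E)$ on $n=|V|$ vertices together with an edge colouring $\mathcal C:E\to\{0,1,2\}$. A map $\phi$ from a set $S\subseteq V$ to $\{0,1,2\}$ is a feasible colouring of $S$ if every edge $uv$ with $u,v\in S$ satisfies $\phi(u)\neq\mathcal C(uv)$ or $\phi(v)\neq\mathcal C(uv)$. The problem asks whether $V$ has a feasible colouring. Running times are counted in unit-cost steps of a random access machine with words of $O(\log n)$ bits; the edge colours are given as an $n\times n$ matrix, and the size of the instance is $|(V,\mathcal C)|=|V|+|E|=\Theta(n^2)$. 1. There is an algorithm that, given an instance $(V,\mathcal C)$, a vertex $v_0\in V$ and a feasible colouring of $V\setminus\{v_0\}$, decides in $O(n^6)$ steps whether $V$ has a feasible colouring, and returns one if it exists. 2. There is an algorithm that, given an instance $(V,\mathcal C)$, decides in $O(n^7)=O(|(V,\mathcal C)|^{3.5})$ steps whether $V$ has a feasible colouring, and returns one if it exists. In particular, the 3-Compatible colouring problem is solvable in polynomial time. -/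

import Mathlib

open Filter Asymptotics

/-! ### Compatible colourings of edge-coloured complete graphs -/

/-- A colouring with `k` colours of the edges of the complete graph on the vertex set `V`. -/
abbrev EdgeColouring (V : Type*) (k : ℕ) : Type _ := (⊤ : SimpleGraph V).edgeSet → Fin k

/-- The colour of the edge joining two distinct vertices. -/
def EdgeColouring.colour {V : Type*} {k : ℕ} (C : EdgeColouring V k) (u v : V) (h : u ≠ v) :
    Fin k :=
  C ⟨s(u, v), by simpa using h⟩

/-- `φ` is a feasible colouring of the subgraph induced by `S`: every edge `uv` inside `S` has an
endpoint whose colour differs from the colour of `uv`. -/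
def CompatibleOn {V : Type*} {k : ℕ} (C : EdgeColouring V k) (S : Set V) (φ : V → Fin k) : Prop :=
  ∀ (u v : V) (h : u ≠ v), u ∈ S → v ∈ S → φ u ≠ C.colour u v h ∨ φ v ≠ C.colour u v h

/-- `φ` is a feasible colouring of the whole instance. -/
def Compatible {V : Type*} {k : ℕ} (C : EdgeColouring V k) (φ : V → Fin k) : Prop :=
  ∀ (u v : V) (h : u ≠ v), φ u ≠ C.colour u v h ∨ φ v ≠ C.colour u v h

/-- The size `|V| + |E|` of an instance on `n` vertices. -/
def instanceSize (n : ℕ) : ℕ := n + n.choose 2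

/-! ### Word RAM programs with unit costs -/

namespace RAM

/-- Contents of the registers and of the memory cells. -/
@[ext] structure State where
  reg : ℕ → ℕ
  mem : ℕ → ℕ

/-- Overwrite a register. -/
def State.setReg (s : State) (r x : ℕ) : State := ⟨Function.update s.reg r x, s.mem⟩

/-- Overwrite a memory cell. -/
def State.setMem (s : State) (a x : ℕ) : State := ⟨s.reg, Function.update s.mem a x⟩

/-- Arithmetic instructions; subtraction is truncated at `0`. -/
inductive Op
  | add
  | sub
  | mul

/-- The value computed by an arithmetic instruction. -/
def Op.eval : Op → ℕ → ℕ → ℕ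
  | .add, x, y => x + y
  | .sub, x, y => x - y
  | .mul, x, y => x * y

/-- Programs of a random access machine, with structured control flow. A program is a finite
object: it names finitely many registers and finitely many constants. -/
inductive Prog
  /-- do nothing -/
  | skip
  /-- write the constant `x` to register `r` -/
  | const (r x : ℕ)
  /-- apply an operation to registers `a`, `b` and write the result to register `r` -/
  | arith (o : Op) (r a b : ℕ)
  /-- copy to register `r` the memory cell whose address is in register `a` -/
  | load (r a : ℕ)
  /-- copy register `r` to the memory cell whose address is in register `a` -/
  | store (a r : ℕ)
  /-- first `p`, then `q` -/
  | seq (p q : Prog)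
  /-- run `p` if register `r` is nonzero, and `q` otherwise -/
  | cond (r : ℕ) (p q : Prog)
  /-- as long as register `r` is nonzero, run `p` -/
  | loop (r : ℕ) (p : Prog)

/-- `Exec W p s t s'`: on a machine whose words hold the numbers below `W`, the program `p` started
in the state `s` halts in the state `s'` after exactly `t` steps. Each instruction and each test of
a register takes one step. There is no execution in which a value that is written or an address
that is accessed does not fit into a word. -/
inductive Exec (W : ℕ) : Prog → State → ℕ → State → Prop
  | skip (s : State) : Exec W .skip s 1 s
  | const (s : State) (r x : ℕ) (hx : x < W) : Exec W (.const r x) s 1 (s.setReg r x)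
  | arith (s : State) (o : Op) (r a b : ℕ) (hx : o.eval (s.reg a) (s.reg b) < W) :
      Exec W (.arith o r a b) s 1 (s.setReg r (o.eval (s.reg a) (s.reg b)))
  | load (s : State) (r a : ℕ) (ha : s.reg a < W) (hx : s.mem (s.reg a) < W) :
      Exec W (.load r a) s 1 (s.setReg r (s.mem (s.reg a)))
  | store (s : State) (a r : ℕ) (ha : s.reg a < W) (hx : s.reg r < W) :
      Exec W (.store a r) s 1 (s.setMem (s.reg a) (s.reg r))
  | seq {p q : Prog} {s s₁ s₂ : State} {t₁ t₂ : ℕ} (hp : Exec W p s t₁ s₁)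
      (hq : Exec W q s₁ t₂ s₂) : Exec W (.seq p q) s (t₁ + t₂) s₂
  | cond_true {r : ℕ} {p q : Prog} {s s₁ : State} {t : ℕ} (hr : s.reg r ≠ 0)
      (hp : Exec W p s t s₁) : Exec W (.cond r p q) s (t + 1) s₁
  | cond_false {r : ℕ} {p q : Prog} {s s₁ : State} {t : ℕ} (hr : s.reg r = 0)
      (hq : Exec W q s t s₁) : Exec W (.cond r p q) s (t + 1) s₁
  | loop_step {r : ℕ} {p : Prog} {s s₁ s₂ : State} {t₁ t₂ : ℕ} (hr : s.reg r ≠ 0)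
      (hp : Exec W p s t₁ s₁) (hl : Exec W (.loop r p) s₁ t₂ s₂) :
      Exec W (.loop r p) s (t₁ + t₂ + 1) s₂
  | loop_exit {r : ℕ} {p : Prog} {s : State} (hr : s.reg r = 0) :
      Exec W (.loop r p) s 1 s

/-- The machine is deterministic: the running time and the final state are unique. -/
theorem Exec.unique {W : ℕ} {p : Prog} {s s₁ s₂ : State} {t₁ t₂ : ℕ} (h₁ : Exec W p s t₁ s₁)
    (h₂ : Exec W p s t₂ s₂) : t₁ = t₂ ∧ s₁ = s₂ := by
  induction h₁ generalizing t₂ s₂ with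
  | skip | const | arith | load | store => cases h₂; exact ⟨rfl, rfl⟩
  | seq _ _ ihp ihq =>
    cases h₂ with
    | seq hp hq =>
      obtain ⟨rfl, rfl⟩ := ihp hp
      obtain ⟨rfl, rfl⟩ := ihq hq
      exact ⟨rfl, rfl⟩
  | cond_true hr _ ih =>
    cases h₂ with
    | cond_true _ hp => obtain ⟨rfl, rfl⟩ := ih hp; exact ⟨rfl, rfl⟩
    | cond_false hr' _ => exact absurd hr' hr
  | cond_false hr _ ih =>
    cases h₂ with
    | cond_true hr' _ => exact absurd hr hr'
    | cond_false _ hp => obtain ⟨rfl, rfl⟩ := ih hp; exact ⟨rfl, rfl⟩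
  | loop_step hr _ _ ihp ihl =>
    cases h₂ with
    | loop_step _ hp hl =>
      obtain ⟨rfl, rfl⟩ := ihp hp
      obtain ⟨rfl, rfl⟩ := ihl hl
      exact ⟨rfl, rfl⟩
    | loop_exit hr' => exact absurd hr' hr
  | loop_exit hr =>
    cases h₂ with
    | loop_step hr' _ _ => exact absurd hr hr'
    | loop_exit _ => exact ⟨rfl, rfl⟩

end RAM

/-! ### Input and output conventions -/

/-- The entry `(i, j)` of the `n × n` matrix of edge colours, with `0` on the diagonal (and outside
the matrix). -/
def colourEntry {n k : ℕ} (C : EdgeColouring (Fin n) k) (i j : ℕ) : ℕ :=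
  if h : i < n ∧ j < n ∧ i ≠ j then
    (C.colour ⟨i, h.1⟩ ⟨j, h.2.1⟩ (by simpa using h.2.2) : ℕ)
  else 0

/-- The instance as an input: register `0` holds `n`, and the matrix of edge colours is stored row
by row in the memory cells `0, …, n * n - 1`. All other registers and cells hold `0`. -/
def instanceInput {n k : ℕ} (C : EdgeColouring (Fin n) k) : RAM.State where
  reg r := if r = 0 then n else 0
  mem a := colourEntry C (a / n) (a % n)

/-- The instance together with a vertex `v₀` and a vertex colouring `φ₀`: register `1` holds `v₀`,
and the colour `φ₀ v` is stored in the memory cell `n * n + v`. -/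
def extensionInput {n k : ℕ} (C : EdgeColouring (Fin n) k) (v₀ : Fin n) (φ₀ : Fin n → Fin k) :
    RAM.State where
  reg r := if r = 0 then n else if r = 1 then (v₀ : ℕ) else 0
  mem a := if h : n * n ≤ a ∧ a - n * n < n then (φ₀ ⟨a - n * n, h.2⟩ : ℕ)
    else colourEntry C (a / n) (a % n)

/-- The state `s` gives a correct answer for the instance: either register `0` holds `1` and the
memory cells `n * n + v` hold a feasible colouring, or register `0` holds `0` and there is no
feasible colouring. -/
def IsAnswer {n k : ℕ} (C : EdgeColouring (Fin n) k) (s : RAM.State) : Prop :=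
  (s.reg 0 = 1 ∧ ∃ φ : Fin n → Fin k, Compatible C φ ∧ ∀ v : Fin n, s.mem (n * n + v) = (φ v : ℕ)) ∨
    (s.reg 0 = 0 ∧ ¬ ∃ φ : Fin n → Fin k, Compatible C φ)

/-! The core is the extension of a feasible colouring `F` of all vertices but `v₀`. Fix a
hypothetical feasible colouring `φ` and move `F` towards it: give `v₀` its colour in `φ`, and
whenever a vertex `w` still has its old colour `a` while a changed vertex `u` has colour `a` and the
edge `uw` has colour `a`, recolour `w` by `φ`. The new colour is not `a`, because `u` already has
its colour in `φ`. Each vertex changes at most once. When nothing more is forced, the result is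
feasible: edges between unchanged vertices are good by `F`, edges between changed ones by `φ`, and a
bad mixed edge would force another change (`Guide.feasible_of_closed`).

To run this without `φ`, one must decide between the two colours other than `a`. For each old colour
`a`, guess the last vertex `z` of old colour `a` that was forced to change while both alternatives
were still allowed at it, and guess the choice made there. A vertex `w` of old colour `a` treated
after `z` has a forbidden alternative and takes the other one. A vertex `w` treated before `z`
forbids no alternative at `z`, so the edge `wz` does not have the new colour of `w`; it does not
have colour `a` either, since `F` is feasible; so `w` takes the alternative that differs from the
colour of `wz`. Thus three vertices, three bits and the colour of `v₀` determine the run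
(`Guide.exists_guess`, `Guide.exists_attempt`). There are `O(n³)` guesses, each simulated in `O(n³)`
steps, and every result is checked, so soundness is immediate. Adding the vertices one at a time
costs another factor `n`.

For the machine, the algorithm is written with counting loops. The compiler theorem `Cmd.exec_code`
yields the running time from the loop nesting and the word size from the sizes of expressions;
correctness is proved by the Hoare-style rules for `Cmd.Sat`. -/

/-! ### A small imperative language compiled to random access machines -/

namespace RAM

/-- Expressions over registers and memory. -/
inductive Ex
  | num (x : ℕ)
  | var (r : ℕ)
  | rd (e : Ex)
  | op (o : Op) (e f : Ex)

namespace Ex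

/-- The value of an expression. -/
def eval (s : State) : Ex → ℕ
  | num x => x
  | var r => s.reg r
  | rd e => s.mem (e.eval s)
  | op o e f => o.eval (e.eval s) (f.eval s)

/-- The number of leaves and memory accesses. -/
def size : Ex → ℕ
  | num _ => 1
  | var _ => 1
  | rd e => e.size + 1
  | op _ e f => e.size + f.size

/-- All registers are below `K` and all constants are at most `3`. -/
def wf (K : ℕ) : Ex → Bool
  | num x => x ≤ 3
  | var r => r < K
  | rd e => e.wf K
  | op _ e f => e.wf K && f.wf K

/-- The running time of the compiled expression. -/
def cost : Ex → ℕ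
  | num _ => 1
  | var _ => 2
  | rd e => e.cost + 1
  | op _ e f => e.cost + f.cost + 1

/-- Compute the value in register `k`, using the registers from `k` on. -/
def code : Ex → ℕ → Prog
  | num x, k => .const k x
  -- The machine has no move instruction; a register is copied by adding zero.
  | var r, k => .seq (.const k 0) (.arith .add k r k)
  | rd e, k => .seq (e.code k) (.load k k)
  | op o e f, k => .seq (.seq (e.code k) (f.code (k + 1))) (.arith o k k (k + 1))

end Ex

/-- Registers below `K` and memory hold numbers below `M`. -/
def Bounded (K M : ℕ) (s : State) : Prop :=
  (∀ r < K, s.reg r < M) ∧ ∀ a, s.mem a < M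

/-- The states agree on the memory and on the registers below `K`. -/
def Agree (K : ℕ) (s σ : State) : Prop :=
  σ.mem = s.mem ∧ ∀ r < K, σ.reg r = s.reg r

theorem Ex.size_pos (e : Ex) : 1 ≤ e.size := by
  induction e <;> simp only [size] <;> omega

/-- For bounds that are at least `4`, a sum is bounded by the product as well, so one factor `M` per
leaf suffices; a memory access starts again below `M`. -/
theorem Ex.eval_lt {K M : ℕ} (hM : 4 ≤ M) {s : State} (h : Bounded K M s) (e : Ex)
    (he : e.wf K = true) : e.eval s < M ^ e.size := by
  induction e with
  | num x => simp only [wf, decide_eq_true_eq] at he; simp only [eval, size, pow_one]; omega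
  | var r => simp only [wf, decide_eq_true_eq] at he; simpa [eval, size] using h.1 r he
  | rd e ih =>
    exact (h.2 _).trans_le (Nat.le_self_pow (by simp [size]) M)
  | op o e f ihe ihf =>
    simp only [wf, Bool.and_eq_true] at he
    have h1 := ihe he.1
    have h2 := ihf he.2
    have p1 : 4 ≤ M ^ e.size := hM.trans (Nat.le_self_pow (by have := e.size_pos; omega) M)
    have p2 : 4 ≤ M ^ f.size := hM.trans (Nat.le_self_pow (by have := f.size_pos; omega) M)
    simp only [eval, size, pow_add]
    cases o <;> simp only [Op.eval]
    · nlinarith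
    · calc _ ≤ e.eval s := Nat.sub_le _ _
        _ < _ := h1
        _ ≤ _ := Nat.le_mul_of_pos_right _ (by omega)
    · exact Nat.mul_lt_mul'' h1 h2

/-- Registers are used as a stack: code placed at `k` leaves everything below `k` alone, so the
first operand survives in `k` while the second is computed from `k + 1`. -/
theorem Ex.exec_code {K M W : ℕ} (hM : 4 ≤ M) {s : State} (hb : Bounded K M s) (e : Ex)
    (he : e.wf K = true) (hW : M ^ e.size ≤ W) :
    ∀ {k : ℕ} {σ : State}, K ≤ k → Agree K s σ →
      ∃ σ', Exec W (e.code k) σ e.cost σ' ∧ σ'.reg k = e.eval s ∧ Agree k σ σ' := by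
  induction e with
  | num x =>
    intro k σ hk hs
    refine ⟨_, .const _ _ _ ?_, by simp [State.setReg, eval], rfl, fun r hr => ?_⟩
    · have := eval_lt hM hb (num x) he
      simp only [eval] at this
      omega
    · simp [State.setReg, Function.update_of_ne hr.ne]
  | var r =>
    intro k σ hk hs
    have hlt := eval_lt hM hb (var r) he
    simp only [wf, decide_eq_true_eq] at he
    have hr : r ≠ k := by omega
    refine ⟨_, .seq (.const _ _ _ (by omega)) (.arith _ .add _ _ _ ?_), ?_, rfl, fun q hq => ?_⟩
    · simp only [eval] at hlt
      simp only [Op.eval, State.setReg, Function.update_of_ne hr, Function.update_self, hs.2 r he]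
      omega
    · simp [State.setReg, Op.eval, hr, eval, hs.2 r he]
    · simp [State.setReg, Function.update_of_ne hq.ne]
  | rd e ih =>
    intro k σ hk hs
    have h1 := eval_lt hM hb e he
    have hW' : M ^ e.size ≤ W :=
      (Nat.pow_le_pow_right (by omega) (by simp [size])).trans hW
    have hMW : M ≤ W := (Nat.le_self_pow (by simp [size]) M).trans hW
    obtain ⟨σ', hx, hv, ha⟩ := ih he hW' hk hs
    refine ⟨_, .seq hx (.load _ _ _ (by omega) ?_), ?_, ha.1, fun q hq => ?_⟩
    · rw [ha.1, hs.1]; exact (hb.2 _).trans_le hMW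
    · simp [State.setReg, eval, hv, ha.1, hs.1]
    · simp [State.setReg, Function.update_of_ne hq.ne, ha.2 q hq]
  | op o e f ihe ihf =>
    intro k σ hk hs
    have hlt := eval_lt hM hb (op o e f) he
    simp only [wf, Bool.and_eq_true] at he
    have hWe : M ^ e.size ≤ W :=
      (Nat.pow_le_pow_right (by omega) (by simp [size])).trans hW
    have hWf : M ^ f.size ≤ W :=
      (Nat.pow_le_pow_right (by omega) (by simp [size])).trans hW
    obtain ⟨σ₁, hx₁, hv₁, ha₁⟩ := ihe he.1 hWe hk hs
    have hs₁ : Agree K s σ₁ :=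
      ⟨ha₁.1.trans hs.1, fun r hr => (ha₁.2 r (by omega)).trans (hs.2 r hr)⟩
    obtain ⟨σ₂, hx₂, hv₂, ha₂⟩ := ihf he.2 hWf (k := k + 1) (by omega) hs₁
    have hk₂ : σ₂.reg k = e.eval s := (ha₂.2 k (by omega)).trans hv₁
    refine ⟨_, .seq (.seq hx₁ hx₂) (.arith _ o _ _ _ ?_), ?_, ha₂.1.trans ha₁.1, fun q hq => ?_⟩
    · rw [hk₂, hv₂]; exact hlt.trans_le hW
    · simp [State.setReg, eval, hk₂, hv₂]
    · simp [State.setReg, Function.update_of_ne hq.ne, ha₁.2 q hq, ha₂.2 q (by omega)]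

/-- Commands. In `loop d r b p` the register `r` counts from `0` to the value of register `b`; the
number `d` bounds the number of rounds by `3 * (n + 1) ^ d`. -/
inductive Cmd
  | skip
  | assign (r : ℕ) (e : Ex)
  | write (e f : Ex)
  | seq (p q : Cmd)
  | ite (e : Ex) (p q : Cmd)
  | loop (d r b : ℕ) (p : Cmd)

/-! ### Counting loops: semantics, cost and compilation. -/

namespace Cmd

/-- The states at the starts of the rounds of a loop with counter `r` and body `f`. -/
def rounds (r : ℕ) (f : State → State) (s : State) : ℕ → State
  | 0 => s.setReg r 0
  | i + 1 => (f (rounds r f s i)).setReg r (i + 1)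

/-- The effect of a command. -/
def run : Cmd → State → State
  | skip, s => s
  | assign r e, s => s.setReg r (e.eval s)
  | write e f, s => s.setMem (e.eval s) (f.eval s)
  | seq p q, s => q.run (p.run s)
  | ite e p q, s => if e.eval s = 0 then q.run s else p.run s
  | loop _ r b p, s => rounds r p.run s (s.reg b)

/-- All values written are below `M` and all loops have the claimed number of rounds. -/
def Safe (n M : ℕ) : Cmd → State → Prop
  | skip, _ => True
  | assign _ e, s => e.eval s < M
  | write _ f, s => f.eval s < M
  | seq p q, s => p.Safe n M s ∧ q.Safe n M (p.run s)
  | ite e p q, s => if e.eval s = 0 then q.Safe n M s else p.Safe n M s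
  | loop d r b p, s => s.reg b ≤ 3 * (n + 1) ^ d ∧
      ∀ i < s.reg b, p.Safe n M (rounds r p.run s i)

/-- The command writes to the register `q`. -/
def writes (q : ℕ) : Cmd → Bool
  | skip => false
  | assign r _ => q == r
  | write _ _ => false
  | seq p p' => p.writes q || p'.writes q
  | ite _ p p' => p.writes q || p'.writes q
  | loop _ r _ p => q == r || p.writes q

/-- Registers are below `K`, and loop counters and bounds are not changed by the loop bodies. -/
def wf (K : ℕ) : Cmd → Bool
  | skip => true
  | assign r e => r < K && e.wf K
  | write e f => e.wf K && f.wf K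
  | seq p q => p.wf K && q.wf K
  | ite e p q => e.wf K && p.wf K && q.wf K
  | loop _ r b p => r < K && b < K && r != b && !p.writes r && !p.writes b && p.wf K

/-- A bound for the sizes of expressions. -/
def width : Cmd → ℕ
  | skip => 1
  | assign _ e => e.size
  | write e f => max e.size f.size
  | seq p q => max p.width q.width
  | ite e p q => max e.size (max p.width q.width)
  | loop _ _ _ p => max 2 p.width

/-- The degree of the running time. -/
def deg : Cmd → ℕ
  | seq p q => max p.deg q.deg
  | ite _ p q => max p.deg q.deg
  | loop d _ _ p => d + p.deg
  | _ => 0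

/-- The coefficient of the running time. -/
def coeff : Cmd → ℕ
  | skip => 1
  | assign _ e => e.cost + 2
  | write e f => e.cost + f.cost + 1
  | seq p q => p.coeff + q.coeff
  | ite e p q => e.cost + 1 + p.coeff + q.coeff
  | loop _ _ _ p => 3 * (p.coeff + 12) + 9

/-- Write the value of an expression to a register. -/
def assignCode (K r : ℕ) (e : Ex) : Prog :=
  .seq (e.code (K + 1)) (.seq (.const K 0) (.arith .add r (K + 1) K))

/-- The compiled command; it uses the registers from `K` on for intermediate results. -/
def code (K : ℕ) : Cmd → Prog
  | skip => .skip
  | assign r e => assignCode K r e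
  | write e f => .seq (.seq (e.code K) (f.code (K + 1))) (.store K (K + 1))
  | seq p q => .seq (p.code K) (q.code K)
  | ite e p q => .seq (e.code K) (.cond K (p.code K) (q.code K))
  | loop _ r b p =>
    -- The loop tests register `K`, which holds the number `b - r` of remaining rounds; it is
    -- recomputed after the body, so the body may use `K` as scratch space.
    .seq (.seq (assignCode K r (.num 0)) ((Ex.op .sub (.var b) (.var r)).code K))
      (.loop K (.seq (.seq (p.code K) (assignCode K r (.op .add (.var r) (.num 1))))
        ((Ex.op .sub (.var b) (.var r)).code K)))

theorem rounds_reg (r : ℕ) (f : State → State) (s : State) (i : ℕ) :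
    (rounds r f s i).reg r = i := by
  cases i <;> simp [rounds, State.setReg]

theorem run_reg {q : ℕ} (c : Cmd) (h : c.writes q = false) (s : State) :
    (c.run s).reg q = s.reg q := by
  induction c generalizing s with
  | skip => rfl
  | assign r e =>
    simp only [writes, beq_eq_false_iff_ne, ne_eq] at h
    simp [run, State.setReg, h]
  | write e f => rfl
  | seq p p' ih ih' =>
    simp only [writes, Bool.or_eq_false_iff] at h
    simp [run, ih h.1, ih' h.2]
  | ite e p p' ih ih' =>
    simp only [writes, Bool.or_eq_false_iff] at h
    simp only [run]
    split_ifs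
    · exact ih' h.2 s
    · exact ih h.1 s
  | loop d r b p ih =>
    simp only [writes, Bool.or_eq_false_iff, beq_eq_false_iff_ne, ne_eq] at h
    simp only [run]
    generalize s.reg b = i
    induction i with
    | zero => simp [rounds, State.setReg, h.1]
    | succ i hi => simp [rounds, State.setReg, h.1, ih h.2, hi]

theorem rounds_reg_of_ne {r q : ℕ} (p : Cmd) (h : p.writes q = false) (hq : q ≠ r) (s : State)
    (i : ℕ) : (rounds r p.run s i).reg q = s.reg q := by
  induction i with
  | zero => simp [rounds, State.setReg, hq]
  | succ i ih => simp [rounds, State.setReg, hq, run_reg p h, ih]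

theorem exec_assignCode {K M W : ℕ} (hM : 4 ≤ M) {s σ : State} (hb : Bounded K M s)
    (ha : Agree K s σ) {r : ℕ} (hr : r < K) {e : Ex} (he : e.wf K = true)
    (hW : M ^ e.size ≤ W) (hv : e.eval s < M) :
    ∃ σ', Exec W (assignCode K r e) σ (e.cost + 2) σ' ∧ Agree K (s.setReg r (e.eval s)) σ' ∧
      Bounded K M (s.setReg r (e.eval s)) := by
  have hlt := e.eval_lt hM hb he
  obtain ⟨σ₁, hx, hk, ha₁⟩ := e.exec_code hM hb he hW (k := K + 1) (by omega) ha
  refine ⟨_, .seq hx (.seq (.const _ _ _ (by omega)) (.arith _ .add _ _ _ ?_)), ⟨?_, ?_⟩, ?_, ?_⟩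
  · simp [State.setReg, Op.eval, hk]; omega
  · exact ha₁.1.trans ha.1
  · intro q hq
    have hqK : q ≠ K := by omega
    by_cases hqr : q = r
    · subst hqr; simp [State.setReg, Op.eval, hk]
    · simp [State.setReg, hqr, hqK, ha₁.2 q (by omega), ha.2 q hq]
  · intro q hq
    by_cases hqr : q = r
    · subst hqr; simpa [State.setReg] using hv
    · simpa [State.setReg, hqr] using hb.1 q hq
  · exact hb.2

theorem Agree.trans_ge {K k : ℕ} {s σ σ' : State} (h : Agree K s σ) (h' : Agree k σ σ')
    (hk : K ≤ k) : Agree K s σ' :=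
  ⟨h'.1.trans h.1, fun r hr => (h'.2 r (by omega)).trans (h.2 r hr)⟩

/-- Induction on the number `j` of remaining rounds. The overhead `12` of a round is `6` for the
increment, `5` for the new difference and `1` for the test; the last `1` is the exit test. -/
theorem exec_loop {K M W n : ℕ} (hM : 4 ≤ M) {d r b : ℕ} {p : Cmd}
    (hwf : (loop d r b p).wf K = true) (hW : M ^ (loop d r b p).width ≤ W) {s : State}
    (hb : Bounded K M s)
    (ih : ∀ {s σ : State}, Bounded K M s → Agree K s σ → p.Safe n M s →
      ∃ t σ', Exec W (p.code K) σ t σ' ∧ t ≤ p.coeff * (n + 1) ^ p.deg ∧ Agree K (p.run s) σ' ∧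
        Bounded K M (p.run s))
    (hs : ∀ i < s.reg b, p.Safe n M (rounds r p.run s i)) (j : ℕ) :
    ∀ {i : ℕ} {σ : State}, i + j = s.reg b → Bounded K M (rounds r p.run s i) →
      Agree K (rounds r p.run s i) σ → σ.reg K = j →
      ∃ t σ', Exec W (.loop K (.seq (.seq (p.code K)
          (assignCode K r (.op .add (.var r) (.num 1))))
          ((Ex.op .sub (.var b) (.var r)).code K))) σ t σ' ∧
        t ≤ j * (p.coeff * (n + 1) ^ p.deg + 12) + 1 ∧
        Agree K (rounds r p.run s (s.reg b)) σ' ∧ Bounded K M (rounds r p.run s (s.reg b)) := by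
  simp only [wf, Bool.and_eq_true, decide_eq_true_eq, bne_iff_ne, ne_eq, Bool.not_eq_true'] at hwf
  obtain ⟨⟨⟨⟨⟨hr, hbK⟩, hrb⟩, hpr⟩, hpb⟩, hp⟩ := hwf
  have hW2 : M ^ 2 ≤ W := (Nat.pow_le_pow_right (by omega) (by simp [width])).trans hW
  induction j with
  | zero =>
    intro i σ hi hb' ha hk
    obtain rfl : i = s.reg b := by omega
    exact ⟨1, σ, .loop_exit hk, by simp, ha, hb'⟩
  | succ j ihj =>
    intro i σ hi hb' ha hk
    obtain ⟨t₁, σ₁, hx₁, ht₁, ha₁, hb₁⟩ := ih hb' ha (hs i (by omega))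
    have hreg : (p.run (rounds r p.run s i)).reg r = i := by
      rw [run_reg p hpr, rounds_reg]
    have hev : (Ex.op .add (.var r) (.num 1)).eval (p.run (rounds r p.run s i)) = i + 1 := by
      simp [Ex.eval, Op.eval, hreg]
    have hbM := hb.1 b hbK
    obtain ⟨σ₂, hx₂, ha₂, hb₂⟩ := exec_assignCode (W := W) hM hb₁ ha₁ hr
      (e := .op .add (.var r) (.num 1)) (by simp [Ex.wf, hr]) (by simpa [Ex.size] using hW2)
      (by rw [hev]; omega)
    rw [hev] at ha₂ hb₂
    obtain ⟨σ₃, hx₃, hv₃, ha₃⟩ := (Ex.op .sub (.var b) (.var r)).exec_code (W := W) hM hb₂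
      (by simp [Ex.wf, hr, hbK]) (by simpa [Ex.size] using hW2) le_rfl ha₂
    have hv : σ₃.reg K = j := by
      rw [hv₃]
      have := rounds_reg_of_ne (r := r) p hpb (Ne.symm hrb) s i
      simp [Ex.eval, Op.eval, State.setReg, Ne.symm hrb, run_reg p hpb, this]
      omega
    obtain ⟨t₄, σ₄, hx₄, ht₄, ha₄, hb₄⟩ := ihj (i := i + 1) (by omega) hb₂
      (Agree.trans_ge ha₂ ha₃ le_rfl) hv
    refine ⟨_, σ₄, .loop_step (by omega) (.seq (.seq hx₁ hx₂) hx₃) hx₄, ?_, ha₄, hb₄⟩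
    simp only [Ex.cost]
    rw [add_mul, one_mul]
    omega

/-- The compiled command has the effect of the command and respects the claimed time bound. -/
theorem exec_code {K M W n : ℕ} (hM : 4 ≤ M) (c : Cmd) (hwf : c.wf K = true)
    (hW : M ^ c.width ≤ W) {s σ : State} (hb : Bounded K M s) (ha : Agree K s σ)
    (hs : c.Safe n M s) :
    ∃ t σ', Exec W (c.code K) σ t σ' ∧ t ≤ c.coeff * (n + 1) ^ c.deg ∧ Agree K (c.run s) σ' ∧
      Bounded K M (c.run s) := by
  have hpos : ∀ d, 1 ≤ (n + 1) ^ d := fun d => Nat.one_le_pow _ _ (by omega)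
  have hmono : ∀ {d d'}, d ≤ d' → (n + 1) ^ d ≤ (n + 1) ^ d' := fun h =>
    Nat.pow_le_pow_right (by omega) h
  induction c generalizing s σ with
  | skip => exact ⟨1, σ, .skip σ, by simp [coeff, deg], ha, hb⟩
  | assign r e =>
    simp only [wf, Bool.and_eq_true, decide_eq_true_eq] at hwf
    obtain ⟨σ', hx, ha', hb'⟩ := exec_assignCode hM hb ha hwf.1 hwf.2 hW hs
    exact ⟨_, σ', hx, by simp [coeff, deg], ha', hb'⟩
  | write e f =>
    simp only [wf, Bool.and_eq_true] at hwf
    have hWe : M ^ e.size ≤ W := (Nat.pow_le_pow_right (by omega) (le_max_left _ _)).trans hW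
    have hWf : M ^ f.size ≤ W := (Nat.pow_le_pow_right (by omega) (le_max_right _ _)).trans hW
    have le := e.eval_lt hM hb hwf.1
    have lf := f.eval_lt hM hb hwf.2
    obtain ⟨σ₁, hx₁, hv₁, ha₁⟩ := e.exec_code hM hb hwf.1 hWe le_rfl ha
    obtain ⟨σ₂, hx₂, hv₂, ha₂⟩ := f.exec_code hM hb hwf.2 hWf (k := K + 1) (by omega)
      (Agree.trans_ge ha ha₁ le_rfl)
    have hk : σ₂.reg K = e.eval s := (ha₂.2 K (by omega)).trans hv₁
    refine ⟨_, _, .seq (.seq hx₁ hx₂) (.store _ _ _ (by omega) (by omega)),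
      by simp [coeff, deg], ⟨?_, ?_⟩, hb.1, ?_⟩
    · simp [State.setMem, run, hk, hv₂, ha₂.1, ha₁.1, ha.1]
    · intro q hq
      simp [State.setMem, run, ha₂.2 q (by omega), ha₁.2 q hq, ha.2 q hq]
    · intro a
      simp only [run, State.setMem, Function.update_apply]
      split_ifs
      · exact hs
      · exact hb.2 a
  | seq p q ihp ihq =>
    simp only [wf, Bool.and_eq_true] at hwf
    have hWp : M ^ p.width ≤ W := (Nat.pow_le_pow_right (by omega) (le_max_left _ _)).trans hW
    have hWq : M ^ q.width ≤ W := (Nat.pow_le_pow_right (by omega) (le_max_right _ _)).trans hW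
    obtain ⟨t₁, σ₁, hx₁, ht₁, ha₁, hb₁⟩ := ihp hwf.1 hWp hb ha hs.1
    obtain ⟨t₂, σ₂, hx₂, ht₂, ha₂, hb₂⟩ := ihq hwf.2 hWq hb₁ ha₁ hs.2
    refine ⟨_, σ₂, .seq hx₁ hx₂, ?_, ha₂, hb₂⟩
    simp only [coeff, deg, add_mul]
    exact add_le_add (ht₁.trans (Nat.mul_le_mul_left _ (hmono (le_max_left _ _))))
      (ht₂.trans (Nat.mul_le_mul_left _ (hmono (le_max_right _ _))))
  | ite e p q ihp ihq =>
    simp only [wf, Bool.and_eq_true] at hwf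
    have hWe : M ^ e.size ≤ W := (Nat.pow_le_pow_right (by omega) (le_max_left _ _)).trans hW
    have hWp : M ^ p.width ≤ W :=
      (Nat.pow_le_pow_right (by omega) (by simp [width])).trans hW
    have hWq : M ^ q.width ≤ W :=
      (Nat.pow_le_pow_right (by omega) (by simp [width])).trans hW
    obtain ⟨σ₁, hx₁, hv₁, ha₁⟩ := e.exec_code hM hb hwf.1.1 hWe le_rfl ha
    have ha₁' := Agree.trans_ge ha ha₁ le_rfl
    have hle : e.cost + 1 ≤ (e.cost + 1) * (n + 1) ^ (max p.deg q.deg) :=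
      Nat.le_mul_of_pos_right _ (hpos _)
    simp only [coeff, deg, add_mul _ _ ((n + 1) ^ (max p.deg q.deg)), run]
    have hp := Nat.mul_le_mul_left p.coeff (hmono (le_max_left p.deg q.deg))
    have hq := Nat.mul_le_mul_left q.coeff (hmono (le_max_right p.deg q.deg))
    rw [add_mul] at hle
    simp only [Safe] at hs
    split_ifs at hs ⊢ with h0
    · obtain ⟨t₂, σ₂, hx₂, ht₂, ha₂, hb₂⟩ := ihq hwf.2 hWq hb ha₁' hs
      exact ⟨_, σ₂, .seq hx₁ (.cond_false (by omega) hx₂), by omega, ha₂, hb₂⟩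
    · obtain ⟨t₂, σ₂, hx₂, ht₂, ha₂, hb₂⟩ := ihp hwf.1.2 hWp hb ha₁' hs
      exact ⟨_, σ₂, .seq hx₁ (.cond_true (by omega) hx₂), by omega, ha₂, hb₂⟩
  | loop d r b p ih =>
    have hwf' := hwf
    simp only [wf, Bool.and_eq_true, decide_eq_true_eq, bne_iff_ne, ne_eq,
      Bool.not_eq_true'] at hwf'
    obtain ⟨⟨⟨⟨⟨hr, hbK⟩, hrb⟩, hpr⟩, hpb⟩, hp⟩ := hwf'
    have hW2 : M ^ 2 ≤ W := (Nat.pow_le_pow_right (by omega) (by simp [width])).trans hW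
    have hW1 : M ^ 1 ≤ W := (Nat.pow_le_pow_right (by omega) (by simp)).trans hW2
    have hWp : M ^ p.width ≤ W := (Nat.pow_le_pow_right (by omega) (le_max_right _ _)).trans hW
    obtain ⟨σ₁, hx₁, ha₁, hb₁⟩ := exec_assignCode (W := W) hM hb ha hr (e := .num 0)
      (by simp [Ex.wf]) (by simpa [Ex.size] using hW1) (by simp [Ex.eval]; omega)
    simp only [Ex.eval] at ha₁ hb₁
    obtain ⟨σ₂, hx₂, hv₂, ha₂⟩ := (Ex.op .sub (.var b) (.var r)).exec_code (W := W) hM hb₁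
      (by simp [Ex.wf, hr, hbK]) (by simpa [Ex.size] using hW2) le_rfl ha₁
    have hv : σ₂.reg K = s.reg b := by
      rw [hv₂]; simp [Ex.eval, Op.eval, State.setReg, Ne.symm hrb]
    obtain ⟨t₃, σ₃, hx₃, ht₃, ha₃, hb₃⟩ := exec_loop hM hwf hW hb
      (fun hb ha hs => ih hp hWp hb ha hs) hs.2 (s.reg b) (i := 0) (by simp) hb₁
      (Agree.trans_ge ha₁ ha₂ le_rfl) hv
    refine ⟨_, σ₃, .seq (.seq hx₁ hx₂) hx₃, ?_, ha₃, hb₃⟩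
    -- The constant `9` is `3` for zeroing the counter, `5` for the first difference and `1` for the
    -- exit test.
    simp only [coeff, deg, Ex.cost, pow_add]
    have h1 := hs.1
    have hP := hpos p.deg
    have hD := hpos d
    have hPD : 1 ≤ (n + 1) ^ d * (n + 1) ^ p.deg := Nat.one_le_iff_ne_zero.2 (by positivity)
    have : s.reg b * (p.coeff * (n + 1) ^ p.deg + 12) ≤
        3 * (n + 1) ^ d * (p.coeff * (n + 1) ^ p.deg + 12 * (n + 1) ^ p.deg) :=
      Nat.mul_le_mul h1 (by omega)
    calc _ ≤ 3 * (n + 1) ^ d * (p.coeff * (n + 1) ^ p.deg + 12 * (n + 1) ^ p.deg) +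
          9 * ((n + 1) ^ d * (n + 1) ^ p.deg) := by omega
      _ = _ := by ring

end Cmd

end RAM

/-! ### Extending a colouring by one vertex -/

namespace Extend

/-- `ψ` is a feasible colouring of the vertices below `m`, where `C` is the matrix of edge
colours. -/
def Feasible (C : ℕ → ℕ → ℕ) (m : ℕ) (ψ : ℕ → ℕ) : Prop :=
  ∀ u < m, ∀ w < m, u ≠ w → ¬ (ψ u = C u w ∧ ψ w = C u w)

/-- The colour `x` is forbidden at `w` by a vertex at which `ψ` differs from `F`. -/
def Hit (C : ℕ → ℕ → ℕ) (F : ℕ → ℕ) (m : ℕ) (ψ : ℕ → ℕ) (x w : ℕ) : Prop :=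
  ∃ u < m, ψ u ≠ F u ∧ ψ u = x ∧ C u w = x

/-- The first colour different from `a`. -/
def alt₁ (a : ℕ) : ℕ := if a = 0 then 1 else 0

/-- The second colour different from `a`. -/
def alt₂ (a : ℕ) : ℕ := if a = 2 then 1 else 2

/-- The vertex `w` still has its old colour `a`, but that colour has become forbidden. -/
def Active (C : ℕ → ℕ → ℕ) (F : ℕ → ℕ) (m : ℕ) (w a : ℕ) (ψ : ℕ → ℕ) : Prop :=
  F w = a ∧ ψ w = a ∧ Hit C F m ψ a w

/-- The rule by which the new colour of a vertex of old colour `a` is chosen, given the last vertex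
`z` of old colour `a` at which there was a choice, and the choice `g` made there. -/
def Second (C : ℕ → ℕ → ℕ) (F : ℕ → ℕ) (m z g a w : ℕ) (ψ : ℕ → ℕ) : Prop :=
  if ψ z = F z then (if w = z then g ≠ 0 else C w z = alt₁ a) else Hit C F m ψ (alt₁ a) w

open Classical in
/-- Recolour a vertex if it is active. -/
noncomputable def step (C : ℕ → ℕ → ℕ) (F : ℕ → ℕ) (m : ℕ) (z g : ℕ → ℕ) (ψ : ℕ → ℕ)
    (p : ℕ × ℕ) : ℕ → ℕ :=
  if Active C F m p.1 p.2 ψ then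
    Function.update ψ p.1 (if Second C F m (z p.2) (g p.2) p.2 p.1 ψ then alt₂ p.2 else alt₁ p.2)
  else ψ

open Classical in
/-- Recolour a vertex according to `φ` if it is active. -/
noncomputable def guidedStep (C : ℕ → ℕ → ℕ) (F : ℕ → ℕ) (m : ℕ) (φ : ℕ → ℕ) (ψ : ℕ → ℕ)
    (p : ℕ × ℕ) : ℕ → ℕ :=
  if Active C F m p.1 p.2 ψ then Function.update ψ p.1 (φ p.1) else ψ

/-- One round of steps. -/
def roundList (m : ℕ) : List (ℕ × ℕ) := (List.range m).flatMap fun w => [(w, 0), (w, 1), (w, 2)]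

/-- All steps. -/
def schedule (m : ℕ) : List (ℕ × ℕ) := (List.range m).flatMap fun _ => roundList m

/-- The colouring obtained from the guesses. -/
noncomputable def attempt (C : ℕ → ℕ → ℕ) (F : ℕ → ℕ) (m v₀ c₀ : ℕ) (z g : ℕ → ℕ) : ℕ → ℕ :=
  (schedule m).foldl (step C F m z g) (Function.update F v₀ c₀)

theorem alt_cases {a x : ℕ} (ha : a < 3) (hx : x < 3) (h : x ≠ a) : x = alt₁ a ∨ x = alt₂ a := by
  unfold alt₁ alt₂; split_ifs <;> omega

theorem alt₁_ne_alt₂ (a : ℕ) : alt₁ a ≠ alt₂ a := by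
  unfold alt₁ alt₂; split_ifs <;> omega

theorem alt₁_lt (a : ℕ) : alt₁ a < 3 := by unfold alt₁; split_ifs <;> omega

theorem alt₂_lt (a : ℕ) : alt₂ a < 3 := by unfold alt₂; split_ifs <;> omega

theorem mem_roundList {m : ℕ} {p : ℕ × ℕ} : p ∈ roundList m ↔ p.1 < m ∧ p.2 < 3 := by
  obtain ⟨w, a⟩ := p
  simp only [roundList, List.mem_flatMap, List.mem_range, List.mem_cons, Prod.mk.injEq,
    List.not_mem_nil, or_false]
  constructor
  · rintro ⟨w', hw', h⟩; omega
  · rintro ⟨h1, h2⟩; exact ⟨w, h1, by omega⟩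

theorem mem_schedule {m : ℕ} {p : ℕ × ℕ} (h : p ∈ schedule m) : p.1 < m ∧ p.2 < 3 := by
  simp only [schedule, List.mem_flatMap] at h
  obtain ⟨_, _, h⟩ := h
  exact mem_roundList.1 h

theorem foldl_step_lt {C : ℕ → ℕ → ℕ} {F : ℕ → ℕ} {m : ℕ} (z g : ℕ → ℕ) (L : List (ℕ × ℕ)) :
    ∀ {ψ : ℕ → ℕ}, (∀ v < m, ψ v < 3) → ∀ v < m, L.foldl (step C F m z g) ψ v < 3 := by
  induction L with
  | nil => exact fun h => h
  | cons p L ih =>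
    intro ψ h
    refine ih fun v hv => ?_
    unfold step
    split_ifs
    · rw [Function.update_apply]; split_ifs; exacts [alt₂_lt _, h v hv]
    · rw [Function.update_apply]; split_ifs; exacts [alt₁_lt _, h v hv]
    · exact h v hv

/-- Agreement is needed only at the states that the fold of `g` reaches; `g` will be the guided
process, along which the rule is known to be right. -/
theorem foldl_congr_of_prefix {α β : Type*} {f g : α → β → α} {s : α} {L : List β}
    (h : ∀ L₁ x L₂, L = L₁ ++ x :: L₂ → f (L₁.foldl g s) x = g (L₁.foldl g s) x) :
    L.foldl f s = L.foldl g s := by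
  induction L using List.reverseRecOn with
  | nil => rfl
  | append_singleton L x ih =>
    rw [List.foldl_append, List.foldl_append, ih, List.foldl_cons, List.foldl_cons,
      h L x [] rfl, List.foldl_nil, List.foldl_nil]
    intro L₁ y L₂ hL
    exact h L₁ y (L₂ ++ [x]) (by simp [hL])

/-! ### The recolouring process guided by a feasible colouring. -/

section Guided

/-- The data of a colouring `F` of the vertices below `m` other than `v₀`, and of a feasible
colouring `φ` of all of them. -/
structure Guide (C : ℕ → ℕ → ℕ) (F : ℕ → ℕ) (m v₀ : ℕ) (φ : ℕ → ℕ) : Prop where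
  symm : ∀ u < m, ∀ w < m, C u w = C w u
  colour_lt : ∀ u < m, ∀ w < m, C u w < 3
  v₀_lt : v₀ < m
  -- A sentinel outside the colours: once `v₀` has a genuine colour it counts as changed and is
  -- never active.
  old_v₀ : F v₀ = 3
  old : ∀ u < m, ∀ w < m, u ≠ v₀ → w ≠ v₀ → u ≠ w → ¬ (F u = C u w ∧ F w = C u w)
  new_lt : ∀ v < m, φ v < 3
  new : Feasible C m φ

variable {C : ℕ → ℕ → ℕ} {F : ℕ → ℕ} {m v₀ : ℕ} {φ : ℕ → ℕ}

/-- `ψ` arises from `F` by changing some colours to those of `φ`, among them the colour of `v₀`. -/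
def Between (F : ℕ → ℕ) (m v₀ : ℕ) (φ ψ : ℕ → ℕ) : Prop :=
  ψ v₀ = φ v₀ ∧ ∀ v < m, ψ v ≠ F v → ψ v = φ v

/-- The vertex that forbids `x` is changed, hence already coloured by `φ`, so the same edge forbids
`x` at `w` for `φ`. -/
theorem Guide.new_ne (G : Guide C F m v₀ φ) {ψ : ℕ → ℕ} (hψ : Between F m v₀ φ ψ) {x w : ℕ}
    (hw : w < m) (hψw : ψ w = F w) (h : Hit C F m ψ x w) : φ w ≠ x := by
  obtain ⟨u, hu, hne, hx, hC⟩ := h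
  rintro rfl
  exact G.new u hu w hw (by rintro rfl; exact hne hψw) ⟨by rw [← hψ.2 u hu hne, hx, hC], hC.symm⟩

theorem Guide.ne_v₀ (G : Guide C F m v₀ φ) {ψ : ℕ → ℕ} (hψ : Between F m v₀ φ ψ) {w : ℕ}
    (hψw : ψ w = F w) : w ≠ v₀ := by
  rintro rfl
  have := G.new_lt w G.v₀_lt
  rw [hψ.1, G.old_v₀] at hψw
  omega

theorem Guide.between_step (G : Guide C F m v₀ φ) {ψ : ℕ → ℕ} (hψ : Between F m v₀ φ ψ)
    {p : ℕ × ℕ} : Between F m v₀ φ (guidedStep C F m φ ψ p) := by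
  unfold guidedStep
  split_ifs with h
  · have := G.ne_v₀ hψ (h.2.1.trans h.1.symm)
    refine ⟨by rw [Function.update_of_ne this.symm, hψ.1], fun v hv => ?_⟩
    rw [Function.update_apply]
    split_ifs with hvw
    · subst hvw; simp
    · exact hψ.2 v hv
  · exact hψ

theorem Guide.between_foldl (G : Guide C F m v₀ φ) (L : List (ℕ × ℕ)) {ψ : ℕ → ℕ}
    (hψ : Between F m v₀ φ ψ) : Between F m v₀ φ (L.foldl (guidedStep C F m φ) ψ) := by
  induction L generalizing ψ with
  | nil => exact hψ
  | cons p L ih => exact ih (G.between_step hψ)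

/-- Activity requires the old colour, so changes are permanent. -/
theorem guidedStep_of_ne {ψ : ℕ → ℕ} {p : ℕ × ℕ} {v : ℕ} (hv : ψ v ≠ F v) :
    guidedStep C F m φ ψ p v = ψ v := by
  unfold guidedStep
  split_ifs with h
  · rw [Function.update_of_ne]
    rintro rfl
    exact hv (h.2.1.trans h.1.symm)
  · rfl

theorem foldl_guidedStep_of_ne (L : List (ℕ × ℕ)) {ψ : ℕ → ℕ} {v : ℕ} (hv : ψ v ≠ F v) :
    L.foldl (guidedStep C F m φ) ψ v = ψ v := by
  induction L generalizing ψ with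
  | nil => rfl
  | cons p L ih =>
    have h := guidedStep_of_ne (C := C) (m := m) (φ := φ) (p := p) hv
    rw [List.foldl_cons, ih (by rwa [h]), h]

theorem Guide.step_ne (G : Guide C F m v₀ φ) {ψ : ℕ → ℕ} (hψ : Between F m v₀ φ ψ) {p : ℕ × ℕ}
    (hp : p.1 < m) (h : Active C F m p.1 p.2 ψ) :
    guidedStep C F m φ ψ p p.1 = φ p.1 ∧ φ p.1 ≠ F p.1 := by
  have h' : ψ p.1 = F p.1 := h.2.1.trans h.1.symm
  refine ⟨by simp [guidedStep, h], ?_⟩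
  rw [h.1]
  exact G.new_ne hψ hp h' h.2.2

/-- The case of `w` treated before `z`: `ψ` is the state when `w` is treated, `ψ'` the later state
just before `z` is. The edge `wz` has neither colour `a`, by feasibility of `F`, nor colour `φ w`,
which would then be forbidden at `z` in `ψ'`. Only the third colour is left. -/
theorem Guide.second_of_guess (G : Guide C F m v₀ φ) {ψ ψ' : ℕ → ℕ} {w z a g : ℕ}
    (hψ' : Between F m v₀ φ ψ')
    (hw : w < m) (hz : z < m) (hψ : ψ z = F z) (hψz : ψ' z = F z) (hFz : F z = a) (ha : a < 3)
    (hFw : F w = a) (hw' : ψ' w ≠ F w)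
    (h₁ : ¬ Hit C F m ψ' (alt₁ a) z) (h₂ : ¬ Hit C F m ψ' (alt₂ a) z) :
    Second C F m z g a w ψ ↔ φ w = alt₂ a := by
  have hwz : w ≠ z := by rintro rfl; exact hw' hψz
  have hφw := hψ'.2 w hw hw'
  have hwa : φ w ≠ a := by rw [← hφw, ← hFw]; exact hw'
  have hwv : w ≠ v₀ := by rintro rfl; rw [G.old_v₀] at hFw; omega
  have hCa : C w z ≠ a := fun h => G.old w hw z hz hwv (G.ne_v₀ hψ' hψz) hwz ⟨by rw [hFw, h],
    by rw [hFz, h]⟩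
  have hC := alt_cases ha (G.colour_lt w hw z hz) hCa
  have hφ := alt_cases ha (G.new_lt w hw) hwa
  have hne := alt₁_ne_alt₂ a
  have h₁' : φ w = alt₁ a → C w z ≠ alt₁ a := fun h h' => h₁ ⟨w, hw, hw', by rw [hφw, h], h'⟩
  have h₂' : φ w = alt₂ a → C w z ≠ alt₂ a := fun h h' => h₂ ⟨w, hw, hw', by rw [hφw, h], h'⟩
  simp only [Second, hψ, if_true, hwz, if_false]
  constructor
  · intro h
    rcases hφ with h' | h'
    · exact absurd h (h₁' h')
    · exact h'
  · intro h
    rcases hC with h' | h'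
    · exact h'
    · exact absurd h' (h₂' h)

/-- The case of `w` treated after `z`: `φ` avoids forbidden colours and one alternative is
forbidden, so testing `alt₁ a` alone decides. -/
theorem Guide.second_of_hit (G : Guide C F m v₀ φ) {ψ : ℕ → ℕ} (hψ : Between F m v₀ φ ψ)
    {w z a g : ℕ} (hw : w < m) (ha : a < 3) (hψz : ψ z ≠ F z) (h : Active C F m w a ψ)
    (h' : Hit C F m ψ (alt₁ a) w ∨ Hit C F m ψ (alt₂ a) w) :
    Second C F m z g a w ψ ↔ φ w = alt₂ a := by
  have hψw : ψ w = F w := h.2.1.trans h.1.symm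
  have hφ := alt_cases ha (G.new_lt w hw) (G.new_ne hψ hw hψw h.2.2)
  have hne := alt₁_ne_alt₂ a
  simp only [Second, hψz, if_false]
  constructor
  · intro h1
    exact hφ.resolve_left (G.new_ne hψ hw hψw h1)
  · intro h1
    refine h'.resolve_right fun h2 => ?_
    exact G.new_ne hψ hw hψw h2 h1

/-- For each old colour there are guesses under which the rule chooses the colours of `φ`. -/
theorem Guide.exists_guess (G : Guide C F m v₀ φ) {ψ₀ : ℕ → ℕ} (hψ₀ : Between F m v₀ φ ψ₀)
    {a : ℕ} (ha : a < 3) (L : List (ℕ × ℕ))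
    (hL : ∀ p ∈ L, p.1 < m) :
    ∃ z < m, ∃ g < 2, L.foldl (guidedStep C F m φ) ψ₀ z ≠ F z ∧
      ∀ L₁ w L₂, L = L₁ ++ (w, a) :: L₂ →
        Active C F m w a (L₁.foldl (guidedStep C F m φ) ψ₀) →
        (Second C F m z g a w (L₁.foldl (guidedStep C F m φ) ψ₀) ↔ φ w = alt₂ a) := by
  induction L using List.reverseRecOn with
  | nil =>
    -- Before any choice has occurred `v₀` serves as `z`: it is already changed, so the rule reduces
    -- to the test for forbidden colours.
    refine ⟨v₀, G.v₀_lt, 0, by omega, fun h => G.ne_v₀ hψ₀ h rfl, fun L₁ w L₂ h => ?_⟩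
    simp at h
  | append_singleton L p ih =>
    obtain ⟨z, hz, g, hg, hzF, hrule⟩ := ih fun q hq => hL q (by simp [hq])
    set ψ := L.foldl (guidedStep C F m φ) ψ₀ with hψdef
    have hψ : Between F m v₀ φ ψ := G.between_foldl L hψ₀
    have hp : p.1 < m := hL p (by simp)
    have hsplit : ∀ L₁ w L₂, L ++ [p] = L₁ ++ (w, a) :: L₂ →
        (L₁ = L ∧ p = (w, a)) ∨ ∃ L₂', L = L₁ ++ (w, a) :: L₂' := by
      intro L₁ w L₂ h
      rcases List.eq_nil_or_concat L₂ with rfl | ⟨L₂', q, rfl⟩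
      · obtain ⟨h1, h2⟩ := List.append_inj' h rfl
        exact .inl ⟨h1.symm, by simpa using h2⟩
      · refine .inr ⟨L₂', ?_⟩
        rw [List.concat_eq_append, ← List.cons_append, ← List.append_assoc] at h
        exact (List.append_inj' h rfl).1
    -- If `p` is a genuine choice for old colour `a`, it replaces `z` and all earlier steps of this
    -- colour must be justified anew through it; otherwise `z` is kept.
    by_cases hact : Active C F m p.1 a ψ ∧ p.2 = a ∧ ¬ Hit C F m ψ (alt₁ a) p.1 ∧
        ¬ Hit C F m ψ (alt₂ a) p.1
    · obtain ⟨hact, hpa, h₁, h₂⟩ := hact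
      obtain ⟨w, a'⟩ := p
      obtain rfl : a' = a := hpa
      have hψw : ψ w = F w := hact.2.1.trans hact.1.symm
      have hst := G.step_ne hψ hp hact
      simp only at hst
      refine ⟨w, hp, if φ w = alt₂ a' then 1 else 0, by split_ifs <;> omega, ?_, ?_⟩
      · rw [List.foldl_append, ← hψdef, List.foldl_cons, List.foldl_nil, hst.1]
        exact hst.2
      · intro L₁ w' L₂ hsp hact'
        rcases hsplit L₁ w' L₂ hsp with ⟨rfl, hw'⟩ | ⟨L₂', hL'⟩
        · obtain rfl : w = w' := by simpa using hw'
          simp only [← hψdef, Second, hψw, if_true]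
          split_ifs with h <;> simp [h]
        · set ψ₁ := L₁.foldl (guidedStep C F m φ) ψ₀ with hψ₁def
          have hψ₁ : Between F m v₀ φ ψ₁ := G.between_foldl L₁ hψ₀
          have hw'm : w' < m := hL (w', a') (by simp [hL'])
          have hst' := G.step_ne (p := (w', a')) hψ₁ hw'm hact'
          simp only at hst'
          have hψψ₁ : ψ = L₂'.foldl (guidedStep C F m φ) (guidedStep C F m φ ψ₁ (w', a')) := by
            rw [hψdef, hL', List.foldl_append, List.foldl_cons]
          have hψw' : ψ w' ≠ F w' := by
            rw [hψψ₁, foldl_guidedStep_of_ne, hst'.1]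
            · exact hst'.2
            · rw [hst'.1]; exact hst'.2
          -- Changes are permanent, and `w` is still unchanged in the later state `ψ`.
          have hψ₁w : ψ₁ w = F w := by
            by_contra hne
            have h1 := guidedStep_of_ne (C := C) (m := m) (φ := φ) (p := (w', a')) hne
            rw [hψψ₁, foldl_guidedStep_of_ne _ (by rwa [h1]), h1] at hψw
            exact hne hψw
          exact G.second_of_guess hψ hw'm hp hψ₁w hψw hact.1 ha hact'.1 hψw' h₁ h₂
    · refine ⟨z, hz, g, hg, ?_, fun L₁ w' L₂ hsp hact' => ?_⟩
      · rw [List.foldl_append, ← hψdef, List.foldl_cons, List.foldl_nil, guidedStep_of_ne hzF]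
        exact hzF
      · rcases hsplit L₁ w' L₂ hsp with ⟨rfl, rfl⟩ | ⟨L₂', hL'⟩
        · refine G.second_of_hit hψ hp ha hzF hact' ?_
          by_contra hcon
          rw [not_or] at hcon
          exact hact ⟨hact', rfl, hcon.1, hcon.2⟩
        · exact hrule L₁ w' L₂' hL' hact'

/-! ### Termination of the guided process and feasibility of its result. -/

theorem Hit.mono {ψ ψ' : ℕ → ℕ} (h : ∀ v, ψ v ≠ F v → ψ' v = ψ v) {x w : ℕ}
    (hh : Hit C F m ψ x w) : Hit C F m ψ' x w := by
  obtain ⟨u, hu, hne, hx, hC⟩ := hh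
  exact ⟨u, hu, by rwa [h u hne], by rwa [h u hne], hC⟩

open Classical in
/-- The vertices whose colour has changed. -/
noncomputable def changed (F : ℕ → ℕ) (m : ℕ) (ψ : ℕ → ℕ) : Finset ℕ :=
  (Finset.range m).filter fun v => ψ v ≠ F v

theorem foldl_guidedStep_of_closed {L : List (ℕ × ℕ)} {ψ : ℕ → ℕ}
    (h : ∀ p ∈ L, ¬ Active C F m p.1 p.2 ψ) : L.foldl (guidedStep C F m φ) ψ = ψ := by
  induction L with
  | nil => rfl
  | cons p L ih =>
    rw [List.foldl_cons, guidedStep, if_neg (h p (by simp)), ih fun q hq => h q (by simp [hq])]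

/-- Forbidden colours stay forbidden, so an active vertex either changes before its turn or is still
active when its turn comes. -/
theorem Guide.card_changed_lt (G : Guide C F m v₀ φ) {ψ : ℕ → ℕ} (hψ : Between F m v₀ φ ψ)
    {L : List (ℕ × ℕ)} {p : ℕ × ℕ} (hp : p ∈ L) (hpm : p.1 < m) (h : Active C F m p.1 p.2 ψ) :
    (changed F m ψ).card < (changed F m (L.foldl (guidedStep C F m φ) ψ)).card := by
  refine Finset.card_lt_card ((Finset.ssubset_iff_of_subset fun v hv => ?_).2 ⟨p.1, ?_, ?_⟩)
  · simp only [changed, Finset.mem_filter] at hv ⊢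
    exact ⟨hv.1, by rw [foldl_guidedStep_of_ne L hv.2]; exact hv.2⟩
  · obtain ⟨L₁, L₂, rfl⟩ := List.append_of_mem hp
    simp only [changed, Finset.mem_filter, Finset.mem_range]
    refine ⟨hpm, ?_⟩
    rw [List.foldl_append, List.foldl_cons]
    set ψ₁ := L₁.foldl (guidedStep C F m φ) ψ with hψ₁
    have hb : Between F m v₀ φ ψ₁ := G.between_foldl L₁ hψ
    have hne : guidedStep C F m φ ψ₁ p p.1 ≠ F p.1 := by
      by_cases h1 : ψ₁ p.1 = F p.1
      · have := G.step_ne hb hpm ⟨h.1, h1.trans h.1,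
          h.2.2.mono fun v hv => foldl_guidedStep_of_ne L₁ hv⟩
        rw [this.1]; exact this.2
      · rwa [guidedStep_of_ne h1]
    rwa [foldl_guidedStep_of_ne L₂ hne]
  · simp [changed, h.2.1.trans h.1.symm]

theorem Guide.closed_schedule (G : Guide C F m v₀ φ) {ψ₀ : ℕ → ℕ} (hψ₀ : Between F m v₀ φ ψ₀)
    {w a : ℕ} (hw : w < m) (ha : a < 3) :
    ¬ Active C F m w a ((schedule m).foldl (guidedStep C F m φ) ψ₀) := by
  -- Each round that finds an active vertex adds a changed one. Since `v₀` is changed at the start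
  -- the inequality is strict, so `m` rounds suffice.
  have key : ∀ k, (∀ p ∈ roundList m, ¬ Active C F m p.1 p.2
        (((List.range k).flatMap fun _ => roundList m).foldl (guidedStep C F m φ) ψ₀)) ∨
      k < (changed F m (((List.range k).flatMap fun _ => roundList m).foldl
        (guidedStep C F m φ) ψ₀)).card := by
    intro k
    induction k with
    | zero =>
      refine .inr (Finset.card_pos.2 ⟨v₀, ?_⟩)
      simp only [List.range_zero, List.flatMap_nil, List.foldl_nil, changed, Finset.mem_filter,
        Finset.mem_range]
      exact ⟨G.v₀_lt, fun h => G.ne_v₀ hψ₀ h rfl⟩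
    | succ k ih =>
      rw [List.range_succ, List.flatMap_append, List.foldl_append, List.flatMap_singleton]
      have hb := G.between_foldl ((List.range k).flatMap fun _ => roundList m) hψ₀
      set ψ := ((List.range k).flatMap fun _ => roundList m).foldl (guidedStep C F m φ) ψ₀
      by_cases hcl : ∀ p ∈ roundList m, ¬ Active C F m p.1 p.2 ψ
      · rw [foldl_guidedStep_of_closed hcl]
        exact .inl hcl
      · have hk := ih.resolve_left hcl
        push Not at hcl
        obtain ⟨p, hp, hact⟩ := hcl
        have := G.card_changed_lt hb hp (mem_roundList.1 hp).1 hact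
        exact .inr (by omega)
  rcases key m with h | h
  · exact h (w, a) (mem_roundList.2 ⟨hw, ha⟩)
  · refine absurd h (not_lt.2 ?_)
    refine (Finset.card_filter_le _ _).trans ?_
    simp

theorem Guide.feasible_of_closed (G : Guide C F m v₀ φ) (hF : ∀ v < m, v ≠ v₀ → F v < 3)
    {ψ : ℕ → ℕ} (hψ : Between F m v₀ φ ψ)
    (h : ∀ w < m, ∀ a < 3, ¬ Active C F m w a ψ) : Feasible C m ψ := by
  -- On a bad edge from a changed to an unchanged vertex the common colour is `F w`, which makes `w`
  -- active.
  have key : ∀ u < m, ∀ w < m, ψ u ≠ F u → ψ w = F w → ¬ (ψ u = C u w ∧ ψ w = C u w) := by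
    intro u hu w hw hne hwF hc
    refine h w hw (F w) (hF w hw (G.ne_v₀ hψ hwF)) ⟨rfl, hwF, u, hu, hne, ?_, ?_⟩
    · rw [hc.1, ← hc.2, hwF]
    · rw [← hc.2, hwF]
  intro u hu w hw huw hc
  by_cases hu' : ψ u = F u <;> by_cases hw' : ψ w = F w
  · exact G.old u hu w hw (G.ne_v₀ hψ hu') (G.ne_v₀ hψ hw') huw
      ⟨by rw [← hu', hc.1], by rw [← hw', hc.2]⟩
  · refine key w hw u hu hw' hu' ?_
    rw [← G.symm u hu w hw]
    exact hc.symm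
  · exact key u hu w hw hu' hw' hc
  · exact G.new u hu w hw huw ⟨by rw [← hψ.2 u hu hu', hc.1], by rw [← hψ.2 w hw hw', hc.2]⟩

/-- If there is a feasible colouring then some guesses lead to one. -/
theorem Guide.exists_attempt (G : Guide C F m v₀ φ) (hF : ∀ v < m, v ≠ v₀ → F v < 3) :
    ∃ z g : ℕ → ℕ, (∀ a < 3, z a < m ∧ g a < 2) ∧
      Feasible C m (attempt C F m v₀ (φ v₀) z g) := by
  set ψ₀ := Function.update F v₀ (φ v₀) with hψ₀def
  have hψ₀' : ∀ v, v ≠ v₀ → ψ₀ v = F v := fun v hv => Function.update_of_ne hv _ _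
  have hψ₀ : Between F m v₀ φ ψ₀ := by
    refine ⟨by simp [hψ₀def], fun v _ hv => ?_⟩
    obtain rfl : v = v₀ := by by_contra h; exact hv (hψ₀' v h)
    simp [hψ₀def]
  -- The guided run does not depend on the guesses, so they can be chosen for each old colour
  -- separately. The premise `a < 3` is placed inside so that `choose` gives total functions.
  have hex : ∀ a : ℕ, ∃ z g : ℕ, a < 3 → z < m ∧ g < 2 ∧
      ∀ L₁ w L₂, schedule m = L₁ ++ (w, a) :: L₂ →
        Active C F m w a (L₁.foldl (guidedStep C F m φ) ψ₀) →
        (Second C F m z g a w (L₁.foldl (guidedStep C F m φ) ψ₀) ↔ φ w = alt₂ a) := by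
    intro a
    by_cases ha : a < 3
    · obtain ⟨z, hz, g, hg, -, h⟩ := G.exists_guess hψ₀ ha (schedule m)
        fun p hp => (mem_schedule hp).1
      exact ⟨z, g, fun _ => ⟨hz, hg, h⟩⟩
    · exact ⟨0, 0, fun h => absurd h ha⟩
  choose z g hzg using hex
  refine ⟨z, g, fun a ha => ⟨(hzg a ha).1, (hzg a ha).2.1⟩, ?_⟩
  have heq : attempt C F m v₀ (φ v₀) z g = (schedule m).foldl (guidedStep C F m φ) ψ₀ := by
    refine foldl_congr_of_prefix fun L₁ p L₂ hL => ?_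
    obtain ⟨w, a⟩ := p
    obtain ⟨hw, ha⟩ := mem_schedule (m := m) (p := (w, a)) (by simp [hL])
    have hb := G.between_foldl L₁ hψ₀
    have hr := (hzg a ha).2.2 L₁ w L₂ hL
    generalize L₁.foldl (guidedStep C F m φ) ψ₀ = ψ at hb hr
    by_cases hact : Active C F m w a ψ
    · have hne := G.step_ne (p := (w, a)) hb hw hact
      have hc := alt_cases ha (G.new_lt w hw) (by rw [← hact.1]; exact hne.2)
      simp only [step, guidedStep, hact, if_true, hr hact]
      split_ifs with h
      · rw [h]
      · rw [hc.resolve_right h]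
    · simp only [step, guidedStep, hact, if_false]
  rw [heq]
  exact G.feasible_of_closed hF (G.between_foldl _ hψ₀)
    fun w hw a ha => G.closed_schedule hψ₀ hw ha

end Guided

end Extend

/-! ### Reasoning about commands -/

namespace RAM

theorem State.setReg_self (s : State) (r x : ℕ) : (s.setReg r x).reg r = x :=
  Function.update_self _ _ _

theorem State.setReg_of_ne (s : State) {r q : ℕ} (x : ℕ) (h : q ≠ r) :
    (s.setReg r x).reg q = s.reg q :=
  Function.update_of_ne h _ _

namespace Cmd

/-- Run from `s`, the command is safe for word size `(n + 2) ^ 2` and establishes `Q`. -/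
def Sat (n : ℕ) (c : Cmd) (s : State) (Q : State → Prop) : Prop :=
  c.Safe n ((n + 2) ^ 2) s ∧ Q (c.run s)

variable {n : ℕ} {s : State} {Q : State → Prop}

theorem Sat.mono {c : Cmd} {Q' : State → Prop} (h : c.Sat n s Q) (hQ : ∀ s', Q s' → Q' s') :
    c.Sat n s Q' :=
  ⟨h.1, hQ _ h.2⟩

/-- Preservation of registers that are not written is syntactic; in this way guesses and counters
survive nested commands. -/
theorem Sat.frame {c : Cmd} (h : c.Sat n s Q) :
    c.Sat n s fun s' => Q s' ∧ ∀ q, c.writes q = false → s'.reg q = s.reg q :=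
  ⟨h.1, h.2, fun _ hq => run_reg c hq s⟩

theorem sat_skip (h : Q s) : Cmd.skip.Sat n s Q := ⟨trivial, h⟩

theorem sat_assign {r : ℕ} {e : Ex} (hv : e.eval s < (n + 2) ^ 2) (h : Q (s.setReg r (e.eval s))) :
    (assign r e).Sat n s Q := ⟨hv, h⟩

theorem sat_write {e f : Ex} (hv : f.eval s < (n + 2) ^ 2)
    (h : Q (s.setMem (e.eval s) (f.eval s))) : (write e f).Sat n s Q := ⟨hv, h⟩

theorem sat_seq {p q : Cmd} (h : p.Sat n s fun s' => q.Sat n s' Q) : (seq p q).Sat n s Q :=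
  ⟨⟨h.1, h.2.1⟩, h.2.2⟩

theorem sat_ite {e : Ex} {p q : Cmd} (hp : e.eval s ≠ 0 → p.Sat n s Q)
    (hq : e.eval s = 0 → q.Sat n s Q) : (ite e p q).Sat n s Q := by
  by_cases h : e.eval s = 0
  · simpa [Sat, Safe, run, h] using hq h
  · simpa [Sat, Safe, run, h] using hp h

/-- The invariant `I i` holds at the start of round `i`; it need not mention registers that the body
does not write. -/
theorem sat_loop {d r b : ℕ} {p : Cmd} (I : ℕ → State → Prop) (hd : s.reg b ≤ 3 * (n + 1) ^ d)
    (h₀ : I 0 (s.setReg r 0))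
    (hI : ∀ i < s.reg b, ∀ s', s'.reg r = i →
      (∀ q, q ≠ r → p.writes q = false → s'.reg q = s.reg q) → I i s' →
      p.Sat n s' fun s'' => I (i + 1) (s''.setReg r (i + 1)))
    (hQ : ∀ s', (∀ q, q ≠ r → p.writes q = false → s'.reg q = s.reg q) → I (s.reg b) s' → Q s') :
    (loop d r b p).Sat n s Q := by
  have hf : ∀ i q, q ≠ r → p.writes q = false → (rounds r p.run s i).reg q = s.reg q :=
    fun i q hq hp => rounds_reg_of_ne p hp hq s i
  have key : ∀ i ≤ s.reg b, I i (rounds r p.run s i) := by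
    intro i
    induction i with
    | zero => exact fun _ => h₀
    | succ i ih =>
      intro hi
      exact (hI i (by omega) _ (rounds_reg _ _ _ _) (hf i) (ih (by omega))).2
  refine ⟨⟨hd, fun i hi => ?_⟩, hQ _ (hf _) (key _ le_rfl)⟩
  exact (hI i hi _ (rounds_reg _ _ _ _) (hf i) (key i hi.le)).1

/-- Zero if and only if the values agree. -/
def _root_.RAM.Ex.ne (e f : Ex) : Ex := .op .add (.op .sub e f) (.op .sub f e)

theorem _root_.RAM.Ex.eval_ne_eq_zero {e f : Ex} : (e.ne f).eval s = 0 ↔ e.eval s = f.eval s := by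
  simp only [Ex.ne, Ex.eval, Op.eval]; omega

/-- Run a command if two expressions have the same value. -/
def whenEq (e f : Ex) (p : Cmd) : Cmd := ite (e.ne f) skip p

/-- Run a command if two expressions have different values. -/
def whenNe (e f : Ex) (p : Cmd) : Cmd := ite (e.ne f) p skip

theorem sat_whenEq {e f : Ex} {p : Cmd} (hp : e.eval s = f.eval s → p.Sat n s Q)
    (hq : e.eval s ≠ f.eval s → Q s) : (whenEq e f p).Sat n s Q :=
  sat_ite (fun h => sat_skip (hq (mt Ex.eval_ne_eq_zero.2 h))) fun h => hp (Ex.eval_ne_eq_zero.1 h)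

theorem sat_whenNe {e f : Ex} {p : Cmd} (hp : e.eval s ≠ f.eval s → p.Sat n s Q)
    (hq : e.eval s = f.eval s → Q s) : (whenNe e f p).Sat n s Q :=
  sat_ite (fun h => hp (mt Ex.eval_ne_eq_zero.2 h)) fun h => sat_skip (hq (Ex.eval_ne_eq_zero.1 h))

end Cmd

end RAM

/-! ### The program -/

namespace Extend

open RAM RAM.Cmd

/-- Register `0` holds `n`, the registers `3`, `4`, `5` hold the addresses of three arrays behind
the matrix `C` of edge colours, and the registers `22` and `23` hold `3` and `2`. -/
structure Base (n : ℕ) (C : ℕ → ℕ → ℕ) (s : State) : Prop where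
  size : s.reg 0 = n
  addr : ∀ j < 3, s.reg (3 + j) = n * n + j * n
  three : s.reg 22 = 3
  two : s.reg 23 = 2
  matrix : ∀ i < n, ∀ j < n, s.mem (i * n + j) = C i j
  -- The bound is `3` and not `2` because the sentinel at `v₀` is stored as well.
  small : ∀ a, s.mem a ≤ 3

/-- Moreover registers `1` and `2` hold `v₀` and `m`, and the arrays hold `A 0` (the output),
`A 1` (the old colouring) and `A 2` (the current colouring). -/
structure Env (n m v₀ : ℕ) (C A : ℕ → ℕ → ℕ) (s : State) : Prop where
  base : Base n C s
  le : m ≤ n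
  lt : v₀ < m
  vertex : s.reg 1 = v₀
  active : s.reg 2 = m
  array : ∀ j < 3, ∀ v < m, s.mem (n * n + j * n + v) = A j v

theorem Base.congr {n : ℕ} {C : ℕ → ℕ → ℕ} {s s' : State} (h : Base n C s) (hm : s'.mem = s.mem)
    (hr : ∀ q, q = 0 ∨ q = 3 ∨ q = 4 ∨ q = 5 ∨ q = 22 ∨ q = 23 → s'.reg q = s.reg q) :
    Base n C s' where
  size := by rw [hr 0 (by omega), h.size]
  addr j hj := by rw [hr _ (by omega), h.addr j hj]
  three := by rw [hr _ (by omega), h.three]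
  two := by rw [hr _ (by omega), h.two]
  matrix := by rw [hm]; exact h.matrix
  small := by rw [hm]; exact h.small

theorem Base.setReg {n : ℕ} {C : ℕ → ℕ → ℕ} {s : State} (h : Base n C s) {r : ℕ} (x : ℕ)
    (hr : r ≠ 0 ∧ r ≠ 3 ∧ r ≠ 4 ∧ r ≠ 5 ∧ r ≠ 22 ∧ r ≠ 23) : Base n C (s.setReg r x) :=
  h.congr rfl fun q hq => Function.update_of_ne (by omega) _ _

variable {n m v₀ : ℕ} {C A : ℕ → ℕ → ℕ} {s : State}

theorem Env.congr {s' : State} (h : Env n m v₀ C A s)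
    (hm : s'.mem = s.mem)
    (hr : ∀ q, q ≤ 5 ∨ q = 22 ∨ q = 23 → s'.reg q = s.reg q) :
    Env n m v₀ C A s' where
  base := h.base.congr hm fun q hq => hr q (by omega)
  le := h.le
  lt := h.lt
  vertex := by rw [hr _ (by omega), h.vertex]
  active := by rw [hr _ (by omega), h.active]
  array := by rw [hm]; exact h.array

theorem Env.setReg (h : Env n m v₀ C A s) {r : ℕ} (x : ℕ) (hr : 6 ≤ r ∧ r ≠ 22 ∧ r ≠ 23) :
    Env n m v₀ C A (s.setReg r x) :=
  h.congr rfl fun q hq => Function.update_of_ne (by omega) _ _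

theorem Env.congr_array {A' : ℕ → ℕ → ℕ} (h : Env n m v₀ C A s)
    (hA : ∀ j < 3, ∀ v < m, A j v = A' j v) : Env n m v₀ C A' s :=
  { h with array := fun j hj v hv => (h.array j hj v hv).trans (hA j hj v hv) }

theorem Env.array_le (h : Env n m v₀ C A s) {j v : ℕ} (hj : j < 3) (hv : v < m) : A j v ≤ 3 := by
  rw [← h.array j hj v hv]; exact h.base.small _

/-- The matrix lies below `n * n` and the arrays are spaced `n ≥ m` apart, so the write affects a
single entry. -/
theorem Env.setMem (h : Env n m v₀ C A s) {j w x : ℕ} (hj : j < 3) (hw : w < m) (hx : x ≤ 3) :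
    Env n m v₀ C (Function.update A j (Function.update (A j) w x))
      (s.setMem (n * n + j * n + w) x) where
  base :=
    { size := h.base.size
      addr := h.base.addr
      three := h.base.three
      two := h.base.two
      matrix := fun i hi k hk => by
        have : i * n + n ≤ n * n := by
          rw [← Nat.succ_mul]; exact Nat.mul_le_mul_right n hi
        have hne : i * n + k ≠ n * n + j * n + w := by omega
        rw [← h.base.matrix i hi k hk]
        exact Function.update_of_ne hne _ _
      small := fun a => by
        simp only [State.setMem, Function.update_apply]
        split_ifs
        · exact hx
        · exact h.base.small a }
  le := h.le
  lt := h.lt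
  vertex := h.vertex
  active := h.active
  array i hi v hv := by
    have hle := h.le
    by_cases hij : i = j
    · subst hij
      simp only [State.setMem, Function.update_self]
      by_cases hvw : v = w
      · subst hvw; simp
      · rw [Function.update_of_ne (by omega), Function.update_of_ne hvw, h.array i hi v hv]
    · rw [Function.update_of_ne hij, ← h.array i hi v hv]
      refine Function.update_of_ne ?_ _ _
      interval_cases i <;> interval_cases j <;> omega

theorem Base.num_lt {x : ℕ} (hx : x ≤ 3) : x < (n + 2) ^ 2 :=
  (show x < 2 ^ 2 by omega).trans_le (Nat.pow_le_pow_left (by omega) 2)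

theorem Env.count_le (h : Env n m v₀ C A s) : s.reg 2 ≤ 3 * (n + 1) ^ 1 := by
  have := h.le
  rw [h.active, pow_one]; omega

/-- The entry of array `j` at the index in register `u`. -/
def entry (j u : ℕ) : Ex := .rd (.op .add (.var (3 + j)) (.var u))

/-- The matrix entry at the indices in registers `u` and `w`. -/
def colourAt (u w : ℕ) : Ex := .rd (.op .add (.op .mul (.var u) (.var 0)) (.var w))

theorem Env.eval_entry (h : Env n m v₀ C A s) {j u : ℕ} (hj : j < 3) (hu : s.reg u < m) :
    (entry j u).eval s = A j (s.reg u) := by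
  simp only [entry, Ex.eval, Op.eval, h.base.addr j hj]
  exact h.array j hj _ hu

theorem Env.eval_colourAt (h : Env n m v₀ C A s) {u w : ℕ} (hu : s.reg u < m) (hw : s.reg w < m) :
    (colourAt u w).eval s = C (s.reg u) (s.reg w) := by
  have := h.le
  simp only [colourAt, Ex.eval, Op.eval, h.base.size]
  exact h.base.matrix _ (by omega) _ (by omega)

/-- Write to array `j` at the index in register `u`. -/
def put (j u : ℕ) (e : Ex) : Cmd := .write (.op .add (.var (3 + j)) (.var u)) e

theorem Env.sat_put (h : Env n m v₀ C A s) {j u : ℕ} {e : Ex} (hj : j < 3) (hu : s.reg u < m)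
    (he : e.eval s ≤ 3) :
    (put j u e).Sat n s
      (Env n m v₀ C (Function.update A j (Function.update (A j) (s.reg u) (e.eval s)))) := by
  refine sat_write (Base.num_lt he) ?_
  simp only [Ex.eval, Op.eval, h.base.addr j hj]
  exact h.setMem hj hu he

/-- Set register `r` to a nonzero number if colour `x` is forbidden at the vertex in register
`16`. -/
def hitCmd (x r : ℕ) : Cmd :=
  .seq (.assign r (.num 0)) (.loop 1 17 2 (whenNe (entry 2 17) (entry 1 17)
    (whenEq (entry 2 17) (.num x) (whenEq (colourAt 17 16) (.num x) (.assign r (.num 1))))))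

theorem Env.sat_hitCmd (h : Env n m v₀ C A s) {x r : ℕ} (hr : r = 18 ∨ r = 19)
    (hw : s.reg 16 < m) :
    (hitCmd x r).Sat n s fun s' => Env n m v₀ C A s' ∧
      (s'.reg r ≠ 0 ↔ Hit C (A 1) m (A 2) x (s.reg 16)) := by
  refine sat_seq (sat_assign (Base.num_lt (by simp [Ex.eval])) ?_)
  set s₁ := s.setReg r ((Ex.num 0).eval s) with hs₁
  have h₁ : Env n m v₀ C A s₁ := h.setReg _ (by omega)
  have hw₁ : s₁.reg 16 = s.reg 16 := Function.update_of_ne (by omega) _ _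
  have hr17 : r ≠ 17 := by omega
  have hr6 : 6 ≤ r ∧ r ≠ 22 ∧ r ≠ 23 := by omega
  have hr16 : 16 ≠ r := by omega
  have hr₁ : s₁.reg r = 0 := State.setReg_self _ _ _
  refine sat_loop (fun i s' => Env n m v₀ C A s' ∧ s'.reg 16 = s.reg 16 ∧
    (s'.reg r ≠ 0 ↔ ∃ u < i, A 2 u ≠ A 1 u ∧ A 2 u = x ∧ C u (s.reg 16) = x))
    h₁.count_le ⟨h₁.setReg _ (by omega), ?_, ?_⟩ ?_ ?_
  · simpa [State.setReg] using hw₁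
  · simp [State.setReg, hr17, hr₁]
  · rintro i hi s' hi' - ⟨hE, hw', hiff⟩
    rw [h₁.active] at hi
    have e2 := hE.eval_entry (j := 2) (u := 17) (by omega) (by omega)
    have e1 := hE.eval_entry (j := 1) (u := 17) (by omega) (by omega)
    have e3 := hE.eval_colourAt (u := 17) (w := 16) (by omega) (by omega)
    rw [hi'] at e1 e2 e3
    rw [hw'] at e3
    -- Shared by the three branches in which a test fails and register `r` is left alone.
    have hno : ¬ (A 2 i ≠ A 1 i ∧ A 2 i = x ∧ C i (s.reg 16) = x) →
        Env n m v₀ C A (s'.setReg 17 (i + 1)) ∧ (s'.setReg 17 (i + 1)).reg 16 = s.reg 16 ∧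
        ((s'.setReg 17 (i + 1)).reg r ≠ 0 ↔
          ∃ u < i + 1, A 2 u ≠ A 1 u ∧ A 2 u = x ∧ C u (s.reg 16) = x) := by
      intro hno
      refine ⟨hE.setReg _ (by omega), by simpa [State.setReg] using hw', ?_⟩
      rw [show (s'.setReg 17 (i + 1)).reg r = s'.reg r from State.setReg_of_ne _ _ hr17, hiff,
        Nat.exists_lt_succ_right]
      exact (or_iff_left hno).symm
    refine sat_whenNe (fun c1 => sat_whenEq (fun c2 => sat_whenEq (fun c3 => ?_) ?_) ?_) ?_
    · rw [e2, e1] at c1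
      rw [e2] at c2
      rw [e3] at c3
      simp only [Ex.eval] at c2 c3
      refine sat_assign (Base.num_lt (by simp [Ex.eval])) ⟨?_, ?_, ?_⟩
      · exact (hE.setReg _ hr6).setReg _ (by decide)
      · simpa [State.setReg, hr16] using hw'
      · simp only [State.setReg, Ex.eval, Function.update_of_ne hr17, Function.update_self]
        exact iff_of_true one_ne_zero ⟨i, by omega, c1, c2, c3⟩
    · intro c
      rw [e3] at c
      exact hno fun c' => c c'.2.2
    · intro c
      rw [e2] at c
      exact hno fun c' => c c'.2.1
    · intro c
      rw [e2, e1] at c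
      exact hno fun c' => c'.1 c
  · rintro s' - ⟨hE, -, hiff⟩
    rw [h₁.active] at hiff
    exact ⟨hE, hiff⟩

/-- Set register `19` according to the rule for vertices of old colour `a`. -/
def secondCmd (a : ℕ) : Cmd :=
  .ite ((entry 2 (9 + a)).ne (entry 1 (9 + a))) (hitCmd (alt₁ a) 19)
    (.ite ((Ex.var 16).ne (.var (9 + a)))
      (.seq (.assign 19 (.num 0))
        (whenEq (colourAt 16 (9 + a)) (.num (alt₁ a)) (.assign 19 (.num 1))))
      (.assign 19 (.var (12 + a))))

theorem Env.sat_secondCmd (h : Env n m v₀ C A s) {a : ℕ} (ha : a < 3) (hw : s.reg 16 < m)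
    (hz : s.reg (9 + a) < m) (hg : s.reg (12 + a) < 2) :
    (secondCmd a).Sat n s fun s' => Env n m v₀ C A s' ∧
      (s'.reg 19 ≠ 0 ↔
        Second C (A 1) m (s.reg (9 + a)) (s.reg (12 + a)) a (s.reg 16) (A 2)) := by
  have e2 := h.eval_entry (j := 2) (by omega) hz
  have e1 := h.eval_entry (j := 1) (by omega) hz
  refine sat_ite (fun c => ?_) fun c => sat_ite (fun c' => ?_) fun c' => ?_
  · rw [ne_eq, Ex.eval_ne_eq_zero, e1, e2] at c
    refine (h.sat_hitCmd (by simp) hw).mono fun s' hs' => ?_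
    rwa [Second, if_neg c]
  · rw [Ex.eval_ne_eq_zero, e1, e2] at c
    rw [ne_eq, Ex.eval_ne_eq_zero] at c'
    simp only [Ex.eval] at c'
    have hz' : 9 + a ≠ 19 := by omega
    refine sat_seq (sat_assign (Base.num_lt (by simp [Ex.eval])) ?_)
    have h' : Env n m v₀ C A (s.setReg 19 ((Ex.num 0).eval s)) := h.setReg _ (by omega)
    have e3 := h'.eval_colourAt (u := 16) (w := 9 + a) (by simpa [State.setReg] using hw)
      (by simpa [State.setReg, hz'] using hz)
    refine sat_whenEq (fun c3 => sat_assign (Base.num_lt (by simp [Ex.eval]))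
      ⟨h'.setReg _ (by omega), ?_⟩) fun c3 => ⟨h', ?_⟩
    · rw [e3] at c3
      simp only [Second, c, if_true, c', if_false]
      simpa [State.setReg, hz', Ex.eval] using c3
    · rw [e3] at c3
      simp only [Second, c, if_true, c', if_false]
      simpa [State.setReg, hz', Ex.eval] using c3
  · rw [Ex.eval_ne_eq_zero, e1, e2] at c
    rw [Ex.eval_ne_eq_zero] at c'
    simp only [Ex.eval] at c'
    refine sat_assign (Base.num_lt (by simp only [Ex.eval]; omega)) ⟨h.setReg _ (by omega), ?_⟩
    simp [Second, c, c', State.setReg, Ex.eval]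

/-- Recolour the vertex in register `16` if it is active with old colour `a`. -/
def stepCmd (a : ℕ) : Cmd :=
  whenEq (entry 1 16) (.num a) (whenEq (entry 2 16) (.num a) (.seq (hitCmd a 18)
    (whenNe (.var 18) (.num 0) (.seq (secondCmd a)
      (.ite (.var 19) (put 2 16 (.num (alt₂ a))) (put 2 16 (.num (alt₁ a))))))))

theorem Env.sat_stepCmd (h : Env n m v₀ C A s) {a : ℕ} (ha : a < 3) (hw : s.reg 16 < m)
    {z g : ℕ → ℕ} (hz : s.reg (9 + a) = z a) (hg : s.reg (12 + a) = g a) (hzm : z a < m)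
    (hg2 : g a < 2) :
    (stepCmd a).Sat n s (Env n m v₀ C
      (Function.update A 2 (step C (A 1) m z g (A 2) (s.reg 16, a)))) := by
  have e2 := h.eval_entry (j := 2) (by omega) hw
  have e1 := h.eval_entry (j := 1) (by omega) hw
  have hno : ∀ s', Env n m v₀ C A s' → ¬ Active C (A 1) m (s.reg 16) a (A 2) →
      Env n m v₀ C (Function.update A 2 (step C (A 1) m z g (A 2) (s.reg 16, a))) s' := by
    intro s' h' hn
    simpa [step, hn] using h'
  refine sat_whenEq (fun c1 => sat_whenEq (fun c2 => sat_seq ?_) fun c2 => ?_) fun c1 => ?_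
  · rw [e1] at c1
    rw [e2] at c2
    simp only [Ex.eval] at c1 c2
    refine (h.sat_hitCmd (r := 18) (by simp) hw).frame.mono fun s₁ ⟨⟨h₁, hit⟩, hf⟩ => ?_
    refine sat_whenNe (fun c3 => sat_seq ?_) fun c3 => hno _ h₁ fun hact => ?_
    · have hact : Active C (A 1) m (s.reg 16) a (A 2) := ⟨c1, c2, hit.1 c3⟩
      have f16 := hf 16 rfl
      have fz : s₁.reg (9 + a) = s.reg (9 + a) := hf _ (by interval_cases a <;> rfl)
      have fg : s₁.reg (12 + a) = s.reg (12 + a) := hf _ (by interval_cases a <;> rfl)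
      refine (h₁.sat_secondCmd ha (by omega) (by omega) (by omega)).frame.mono
        fun s₂ ⟨⟨h₂, sec⟩, hf₂⟩ => ?_
      have f16' : s₂.reg 16 = s.reg 16 := (hf₂ 16 (by interval_cases a <;> rfl)).trans f16
      rw [fz, fg, f16, hz, hg] at sec
      refine sat_ite (fun c4 => ?_) fun c4 => ?_
      · refine (h₂.sat_put (j := 2) (by omega) (by omega) ?_).mono fun s₃ h₃ => ?_
        · have := alt₂_lt a; simp only [Ex.eval]; omega
        · simpa only [step, hact, if_true, sec.1 c4, f16', Ex.eval] using h₃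
      · refine (h₂.sat_put (j := 2) (by omega) (by omega) ?_).mono fun s₃ h₃ => ?_
        · have := alt₁_lt a; simp only [Ex.eval]; omega
        · have c5 := mt sec.2 (not_not.2 c4)
          simpa only [step, hact, if_true, c5, if_false, f16', Ex.eval] using h₃
    · exact hit.2 hact.2.2 c3
  · rw [e2] at c2
    exact hno _ h fun hact => c2 hact.2.1
  · rw [e1] at c1
    exact hno _ h fun hact => c1 hact.1

/-- One round of steps. -/
def roundCmd : Cmd := .loop 1 16 2 (.seq (stepCmd 0) (.seq (stepCmd 1) (stepCmd 2)))

/-- The registers hold the guesses. -/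
def Guessed (m : ℕ) (z g : ℕ → ℕ) (s : State) : Prop :=
  ∀ a < 3, s.reg (9 + a) = z a ∧ s.reg (12 + a) = g a ∧ z a < m ∧ g a < 2

theorem Guessed.congr {z g : ℕ → ℕ} {s s' : State} (h : Guessed m z g s)
    (hr : ∀ q, 9 ≤ q → q ≤ 14 → s'.reg q = s.reg q) : Guessed m z g s' := fun a ha => by
  rw [hr _ (by omega) (by omega), hr _ (by omega) (by omega)]
  exact h a ha

theorem Env.sat_roundCmd (h : Env n m v₀ C A s) {z g : ℕ → ℕ} (hG : Guessed m z g s) :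
    roundCmd.Sat n s (Env n m v₀ C
      (Function.update A 2 ((roundList m).foldl (step C (A 1) m z g) (A 2)))) := by
  refine sat_loop (fun i s' => Env n m v₀ C (Function.update A 2
      (((List.range i).flatMap fun w => [(w, 0), (w, 1), (w, 2)]).foldl
        (step C (A 1) m z g) (A 2))) s') h.count_le ?_ ?_ ?_
  · simpa using h.setReg (r := 16) 0 (by omega)
  · intro i hi s' hi' hf h'
    rw [h.active] at hi
    have hG' : Guessed m z g s' := hG.congr fun q _ _ => hf q (by omega) (by interval_cases q <;> rfl)
    have e0 := h'.sat_stepCmd (a := 0) (by omega) (by omega) (hG' 0 (by omega)).1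
      (hG' 0 (by omega)).2.1 (hG' 0 (by omega)).2.2.1 (hG' 0 (by omega)).2.2.2
    refine sat_seq (e0.frame.mono fun s₁ ⟨h₁, f₁⟩ => sat_seq ?_)
    have hG₁ : Guessed m z g s₁ := hG'.congr fun q _ _ => f₁ q (by interval_cases q <;> rfl)
    have i₁ : s₁.reg 16 = i := (f₁ 16 rfl).trans hi'
    have e1 := h₁.sat_stepCmd (a := 1) (by omega) (by omega) (hG₁ 1 (by omega)).1
      (hG₁ 1 (by omega)).2.1 (hG₁ 1 (by omega)).2.2.1 (hG₁ 1 (by omega)).2.2.2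
    refine e1.frame.mono fun s₂ ⟨h₂, f₂⟩ => ?_
    have hG₂ : Guessed m z g s₂ := hG₁.congr fun q _ _ => f₂ q (by interval_cases q <;> rfl)
    have i₂ : s₂.reg 16 = i := (f₂ 16 rfl).trans i₁
    have e2 := h₂.sat_stepCmd (a := 2) (by omega) (by omega) (hG₂ 2 (by omega)).1
      (hG₂ 2 (by omega)).2.1 (hG₂ 2 (by omega)).2.2.1 (hG₂ 2 (by omega)).2.2.2
    refine e2.mono fun s₃ h₃ => ?_
    refine Env.setReg ?_ _ (by omega)
    rw [i₂, i₁, hi'] at h₃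
    simpa [List.range_succ] using h₃
  · intro s' _ h'
    rw [h.active] at h'
    exact h'

/-- All rounds of steps. -/
def roundsCmd : Cmd := .loop 1 15 2 roundCmd

theorem Env.sat_roundsCmd (h : Env n m v₀ C A s) {z g : ℕ → ℕ} (hG : Guessed m z g s) :
    roundsCmd.Sat n s (Env n m v₀ C
      (Function.update A 2 ((schedule m).foldl (step C (A 1) m z g) (A 2)))) := by
  refine sat_loop (fun i s' => Env n m v₀ C (Function.update A 2
      (((List.range i).flatMap fun _ => roundList m).foldl
        (step C (A 1) m z g) (A 2))) s') h.count_le ?_ ?_ ?_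
  · simpa using h.setReg (r := 15) 0 (by omega)
  · intro i hi s' hi' hf h'
    have hG' : Guessed m z g s' := hG.congr fun q _ _ => hf q (by omega) (by interval_cases q <;> rfl)
    refine (h'.sat_roundCmd hG').mono fun s₁ h₁ => ?_
    refine Env.setReg ?_ _ (by omega)
    simpa [List.range_succ] using h₁
  · intro s' _ h'
    rw [h.active] at h'
    exact h'

/-- Copy array `k` to array `j`. -/
def copyCmd (j k : ℕ) : Cmd := .loop 1 20 2 (put j 20 (entry k 20))

theorem Env.sat_copyCmd (h : Env n m v₀ C A s) {j k : ℕ} (hj : j < 3) (hk : k < 3) (hjk : j ≠ k) :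
    (copyCmd j k).Sat n s (Env n m v₀ C (Function.update A j (A k))) := by
  refine sat_loop (fun i s' => Env n m v₀ C (Function.update A j
    (fun v => if v < i then A k v else A j v)) s') h.count_le ?_ ?_ ?_
  · simpa using h.setReg (r := 20) 0 (by omega)
  · intro i hi s' hi' hf h'
    rw [h.active] at hi
    have e := h'.eval_entry (j := k) (u := 20) hk (by omega)
    rw [Function.update_of_ne hjk.symm, hi'] at e
    refine (h'.sat_put hj (by omega) ?_).mono fun s₁ h₁ => Env.setReg ?_ _ (by omega)
    · rw [e]; exact h.array_le hk hi
    · rw [e, hi', Function.update_self, Function.update_idem] at h₁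
      refine h₁.congr_array fun j' _ v _ => ?_
      by_cases hj' : j' = j
      · subst hj'
        simp only [Function.update_self, Function.update_apply]
        split_ifs <;> first | omega | simp_all
      · simp [hj']
  · intro s' _ h'
    rw [h.active] at h'
    refine h'.congr_array fun j' _ v hv => ?_
    by_cases hj' : j' = j
    · subst hj'; simp [hv]
    · simp [hj']

/-- Set register `7` to a nonzero number if the current colouring is feasible. -/
def checkCmd : Cmd :=
  .seq (.assign 7 (.num 1)) (.loop 1 16 2 (.loop 1 17 2 (whenNe (.var 16) (.var 17)
    (whenEq (entry 2 16) (colourAt 16 17) (whenEq (entry 2 17) (colourAt 16 17)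
      (.assign 7 (.num 0)))))))

theorem Env.sat_checkCmd (h : Env n m v₀ C A s) :
    checkCmd.Sat n s fun s' => Env n m v₀ C A s' ∧ (s'.reg 7 ≠ 0 ↔ Feasible C m (A 2)) := by
  refine sat_seq (sat_assign (Base.num_lt (by simp [Ex.eval])) ?_)
  set s₁ := s.setReg 7 ((Ex.num 1).eval s) with hs₁
  have h₁ : Env n m v₀ C A s₁ := h.setReg _ (by omega)
  have hr₁ : s₁.reg 7 = 1 := State.setReg_self _ _ _
  refine sat_loop (fun i s' => Env n m v₀ C A s' ∧
    (s'.reg 7 ≠ 0 ↔ ∀ u < i, ∀ w < m, u ≠ w → ¬ (A 2 u = C u w ∧ A 2 w = C u w)))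
    h₁.count_le ⟨h₁.setReg _ (by omega), by simp [State.setReg, hr₁]⟩ ?_ ?_
  · rintro i hi s₂ hi₂ - ⟨h₂, hiff₂⟩
    rw [h₁.active] at hi
    refine sat_loop (fun k s' => Env n m v₀ C A s' ∧
      (s'.reg 7 ≠ 0 ↔ (∀ u < i, ∀ w < m, u ≠ w → ¬ (A 2 u = C u w ∧ A 2 w = C u w)) ∧
        ∀ w < k, i ≠ w → ¬ (A 2 i = C i w ∧ A 2 w = C i w)))
      h₂.count_le ⟨h₂.setReg _ (by omega), by simpa [State.setReg] using hiff₂⟩ ?_ ?_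
    · rintro k hk s₃ hk₃ hf₃ ⟨h₃, hiff₃⟩
      rw [h₂.active] at hk
      have f16 : s₃.reg 16 = i := (hf₃ 16 (by omega) rfl).trans hi₂
      have e1 := h₃.eval_entry (j := 2) (u := 16) (by omega) (by omega)
      have e2 := h₃.eval_entry (j := 2) (u := 17) (by omega) (by omega)
      have e3 := h₃.eval_colourAt (u := 16) (w := 17) (by omega) (by omega)
      rw [f16] at e1
      rw [hk₃] at e2
      rw [f16, hk₃] at e3
      have hyes : (i ≠ k → ¬ (A 2 i = C i k ∧ A 2 k = C i k)) →
          Env n m v₀ C A (s₃.setReg 17 (k + 1)) ∧ ((s₃.setReg 17 (k + 1)).reg 7 ≠ 0 ↔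
            (∀ u < i, ∀ w < m, u ≠ w → ¬ (A 2 u = C u w ∧ A 2 w = C u w)) ∧
            ∀ w < k + 1, i ≠ w → ¬ (A 2 i = C i w ∧ A 2 w = C i w)) := by
        intro hyes
        refine ⟨h₃.setReg _ (by omega), ?_⟩
        rw [show (s₃.setReg 17 (k + 1)).reg 7 = s₃.reg 7 from State.setReg_of_ne _ _ (by decide),
          hiff₃, Nat.forall_lt_succ_right]
        exact and_congr_right fun _ => (and_iff_left hyes).symm
      refine sat_whenNe (fun c1 => sat_whenEq (fun c2 => sat_whenEq (fun c3 => ?_) ?_) ?_) ?_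
      · rw [e1, e3] at c2
        rw [e2, e3] at c3
        simp only [Ex.eval, f16, hk₃] at c1
        refine sat_assign (Base.num_lt (by simp [Ex.eval]))
          ⟨(h₃.setReg _ (by omega)).setReg _ (by omega), ?_⟩
        refine iff_of_false (by simp [State.setReg, Ex.eval]) fun hc => ?_
        exact hc.2 k (by omega) c1 ⟨c2, c3⟩
      · intro c
        rw [e2, e3] at c
        exact hyes fun _ hc => c hc.2
      · intro c
        rw [e1, e3] at c
        exact hyes fun _ hc => c hc.1
      · intro c
        simp only [Ex.eval, f16, hk₃] at c
        exact hyes fun hc => absurd c hc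
    · rintro s₃ - ⟨h₃, hiff₃⟩
      rw [h₂.active] at hiff₃
      refine ⟨h₃.setReg _ (by omega), ?_⟩
      rw [show (s₃.setReg 16 (i + 1)).reg 7 = s₃.reg 7 from State.setReg_of_ne _ _ (by decide),
        hiff₃, Nat.forall_lt_succ_right]
  · rintro s' - ⟨h', hiff⟩
    rw [h₁.active] at hiff
    exact ⟨h', hiff⟩

end Extend

/-! ### The search and the main programs -/

namespace Extend

open RAM RAM.Cmd

/-- Compute the colouring that belongs to the guesses; if it is feasible, output it. -/
def attemptCmd : Cmd :=
  .seq (copyCmd 2 1) (.seq (put 2 1 (.var 8)) (.seq roundsCmd (.seq checkCmd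
    (whenNe (.var 7) (.num 0) (.seq (copyCmd 0 2) (.assign 6 (.num 1)))))))

/-- The old colouring is `F`, and if register `6` is nonzero then the output is feasible. -/
def Inv (n m v₀ : ℕ) (C : ℕ → ℕ → ℕ) (F : ℕ → ℕ) (s : State) : Prop :=
  ∃ A, Env n m v₀ C A s ∧ A 1 = F ∧ (s.reg 6 ≠ 0 → Feasible C m (A 0) ∧ ∀ v < m, A 0 v < 3)

variable {n m v₀ : ℕ} {C A : ℕ → ℕ → ℕ} {F : ℕ → ℕ} {s : State}

theorem Inv.setReg (h : Inv n m v₀ C F s) {r : ℕ} (x : ℕ) (hr : 7 ≤ r ∧ r ≠ 22 ∧ r ≠ 23) :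
    Inv n m v₀ C F (s.setReg r x) := by
  obtain ⟨A, hE, hF, hA⟩ := h
  refine ⟨A, hE.setReg x (by omega), hF, ?_⟩
  rwa [State.setReg_of_ne _ _ (by omega)]

/-- Register `6` is only ever raised here: a failed attempt keeps an earlier output, and a later
success replaces it by another feasible one. -/
theorem Inv.sat_attemptCmd (h : Inv n m v₀ C F s) (hF : ∀ v < m, v ≠ v₀ → F v < 3) {z g : ℕ → ℕ}
    (hG : Guessed m z g s) (hc : s.reg 8 < 3) :
    attemptCmd.Sat n s fun s' => Inv n m v₀ C F s' ∧
      (s'.reg 6 ≠ 0 ↔ s.reg 6 ≠ 0 ∨ Feasible C m (attempt C F m v₀ (s.reg 8) z g)) := by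
  obtain ⟨A, hE, rfl, hA⟩ := h
  refine sat_seq ((hE.sat_copyCmd (j := 2) (k := 1) (by omega) (by omega) (by omega)).frame.mono
    fun s₁ ⟨h₁, f₁⟩ => sat_seq ?_)
  have f8 : s₁.reg 8 = s.reg 8 := f₁ 8 rfl
  have hv : s₁.reg 1 = v₀ := h₁.vertex
  refine (h₁.sat_put (j := 2) (u := 1) (e := .var 8) (by omega) (by rw [hv]; exact h₁.lt)
    (by simp only [Ex.eval]; omega)).frame.mono fun s₂ ⟨h₂, f₂⟩ => sat_seq ?_
  have hG₂ : Guessed m z g s₂ := hG.congr fun q _ _ =>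
    (f₂ q (by interval_cases q <;> rfl)).trans (f₁ q (by interval_cases q <;> rfl))
  refine (h₂.sat_roundsCmd hG₂).frame.mono fun s₃ ⟨h₃, f₃⟩ => sat_seq ?_
  rw [hv] at h₃
  simp only [Ex.eval, f8, Function.update_idem, Function.update_self, ne_eq, OfNat.one_ne_ofNat,
    not_false_eq_true, Function.update_of_ne] at h₃
  change Env n m v₀ C (Function.update A 2 (attempt C (A 1) m v₀ (s.reg 8) z g)) s₃ at h₃
  refine h₃.sat_checkCmd.frame.mono fun s₄ ⟨⟨h₄, hiff⟩, f₄⟩ => ?_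
  have f6 : s₄.reg 6 = s.reg 6 :=
    (f₄ 6 rfl).trans ((f₃ 6 rfl).trans ((f₂ 6 rfl).trans (f₁ 6 rfl)))
  rw [Function.update_self] at hiff
  refine sat_whenNe (fun c => sat_seq ?_) fun c => ?_
  · refine (h₄.sat_copyCmd (j := 0) (k := 2) (by omega) (by omega) (by omega)).mono
      fun s₅ h₅ => ?_
    refine sat_assign (Base.num_lt (by simp [Ex.eval])) ⟨⟨_, h₅.setReg _ (by omega), ?_, ?_⟩, ?_⟩
    · simp
    · intro _
      simp only [Function.update_self]
      refine ⟨hiff.1 c, foldl_step_lt _ _ _ fun v hv => ?_⟩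
      rw [Function.update_apply]
      split_ifs with hvv
      · exact hc
      · exact hF v hv hvv
    · rw [State.setReg_self]
      exact iff_of_true one_ne_zero (.inr (hiff.1 c))
  · refine ⟨⟨_, h₄, by simp, ?_⟩, ?_⟩
    · simpa [f6] using hA
    · rw [f6, or_iff_left fun hf => hiff.2 hf c]

/-! ### Exhaustive search over the guesses. -/

/-- The number of possible values of the guess in register `r`. -/
def lim (m r : ℕ) : ℕ := if r = 8 then 3 else if r < 12 then m else 2

/-- The register that holds the number of possible values of the guess in register `r`. -/
def limReg (r : ℕ) : ℕ := if r = 8 then 22 else if r < 12 then 2 else 23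

/-- Given guesses in the registers `8, …, j - 1`, the command succeeds if and only if `Q` holds. -/
def Searches (n m v₀ : ℕ) (C : ℕ → ℕ → ℕ) (F : ℕ → ℕ) (j : ℕ) (c : Cmd) (Q : (ℕ → ℕ) → Prop) :
    Prop :=
  ∀ (s : State) (G : ℕ → ℕ), Inv n m v₀ C F s →
    (∀ r, 8 ≤ r → r < j → s.reg r = G r ∧ G r < lim m r) →
    c.Sat n s fun s' => Inv n m v₀ C F s' ∧ (s'.reg 6 ≠ 0 ↔ s.reg 6 ≠ 0 ∨ Q G)

/-- A loop around the search turns one guess into an existential quantifier. Only the vertex guesses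
raise the degree; loops with at most `3` values are absorbed by the factor `3` in `Safe`. -/
theorem Searches.loop {r : ℕ} {c : Cmd} {Q : (ℕ → ℕ) → Prop} (hr : 8 ≤ r ∧ r ≤ 14)
    (h : Searches n m v₀ C F (r + 1) c Q)
    (hw : ∀ q, 8 ≤ q → q < r → c.writes q = false) :
    Searches n m v₀ C F r (.loop (if 9 ≤ r ∧ r < 12 then 1 else 0) r (limReg r) c)
      fun G => ∃ i < lim m r, Q (Function.update G r i) := by
  intro s G hs hG
  have hb : s.reg (limReg r) = lim m r := by
    obtain ⟨A, hE, -, -⟩ := hs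
    unfold limReg lim
    split_ifs
    exacts [hE.base.three, hE.active, hE.base.two]
  have hm : m ≤ n := by
    obtain ⟨A, hE, -, -⟩ := hs
    exact hE.le
  refine sat_loop (fun i s' => Inv n m v₀ C F s' ∧
    (s'.reg 6 ≠ 0 ↔ s.reg 6 ≠ 0 ∨ ∃ k < i, Q (Function.update G r k))) ?_
    ⟨hs.setReg _ (by omega), ?_⟩ ?_ ?_
  · rw [hb]
    unfold lim
    split_ifs <;> simp only [pow_one, pow_zero] <;> omega
  · rw [State.setReg_of_ne _ _ (by omega)]; simp
  · rintro i hi s' hi' hf ⟨hs', hiff⟩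
    rw [hb] at hi
    refine (h s' (Function.update G r i) hs' fun q hq hq' => ?_).mono fun s'' ⟨h1, h2⟩ =>
      ⟨h1.setReg _ (by omega), ?_⟩
    · by_cases hqr : q = r
      · subst hqr; simp [hi', hi]
      · rw [Function.update_of_ne hqr, hf q hqr (hw q hq (by omega))]
        exact hG q hq (by omega)
    · rw [State.setReg_of_ne _ _ (by omega), h2, hiff, or_assoc, Nat.exists_lt_succ_right]
  · rintro s' - ⟨h1, h2⟩
    rw [hb] at h2
    exact ⟨h1, h2⟩

/-- Try all guesses. -/
def searchCmd : Cmd :=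
  .loop 0 8 22 (.loop 1 9 2 (.loop 1 10 2 (.loop 1 11 2 (.loop 0 12 23 (.loop 0 13 23
    (.loop 0 14 23 attemptCmd))))))

theorem attempt_congr {c₀ : ℕ} {z g z' g' : ℕ → ℕ} (h : ∀ a < 3, z a = z' a ∧ g a = g' a) :
    attempt C F m v₀ c₀ z g = attempt C F m v₀ c₀ z' g' := by
  refine List.foldl_ext _ _ _ fun ψ p hp => ?_
  obtain ⟨h1, h2⟩ := h _ (mem_schedule hp).2
  unfold step
  rw [h1, h2]

theorem sat_searchCmd (hF : ∀ v < m, v ≠ v₀ → F v < 3) (hs : Inv n m v₀ C F s) :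
    searchCmd.Sat n s fun s' => Inv n m v₀ C F s' ∧ (s'.reg 6 ≠ 0 ↔ s.reg 6 ≠ 0 ∨
      ∃ c₀ < 3, ∃ z g : ℕ → ℕ, (∀ a < 3, z a < m ∧ g a < 2) ∧
        Feasible C m (attempt C F m v₀ c₀ z g)) := by
  have h15 : Searches n m v₀ C F 15 attemptCmd fun G =>
      Feasible C m (attempt C F m v₀ (G 8) (fun a => G (9 + a)) (fun a => G (12 + a))) := by
    intro s G hs hG
    have h8 := hG 8 (by omega) (by omega)
    beta_reduce
    rw [← h8.1]
    refine hs.sat_attemptCmd hF (fun a ha => ?_) (by rw [h8.1]; exact h8.2)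
    have h9 := hG (9 + a) (by omega) (by omega)
    have h12 := hG (12 + a) (by omega) (by omega)
    rw [lim, if_neg (by omega), if_pos (by omega)] at h9
    rw [lim, if_neg (by omega), if_neg (by omega)] at h12
    exact ⟨h9.1, h12.1, h9.2, h12.2⟩
  -- Seven loops, from the innermost guess outwards, rebuild `searchCmd`.
  have h8 := ((((((h15.loop (r := 14) (by omega) fun q h h' => by interval_cases q <;> rfl).loop
    (r := 13) (by omega) fun q h h' => by interval_cases q <;> rfl).loop
    (r := 12) (by omega) fun q h h' => by interval_cases q <;> rfl).loop
    (r := 11) (by omega) fun q h h' => by interval_cases q <;> rfl).loop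
    (r := 10) (by omega) fun q h h' => by interval_cases q <;> rfl).loop
    (r := 9) (by omega) fun q h h' => (show q = 8 by omega) ▸ rfl).loop
    (r := 8) (by omega) fun q h h' => by omega
  refine (h8 s (fun _ => 0) hs fun r h h' => by omega).mono fun s' ⟨h1, h2⟩ => ⟨h1, ?_⟩
  rw [h2]
  refine or_congr_right ⟨?_, ?_⟩
  · rintro ⟨c₀, hc, z₀, hz₀, z₁, hz₁, z₂, hz₂, g₀, hg₀, g₁, hg₁, g₂, hg₂, hf⟩
    refine ⟨_, ?_, _, _, fun a ha => ?_, hf⟩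
    · simpa [lim] using hc
    · simp only [lim] at *
      interval_cases a <;> simp_all
  · rintro ⟨c₀, hc, z, g, hzg, hf⟩
    refine ⟨c₀, by simpa [lim] using hc, z 0, by simpa [lim] using (hzg 0 (by omega)).1,
      z 1, by simpa [lim] using (hzg 1 (by omega)).1, z 2, by simpa [lim] using (hzg 2 (by omega)).1,
      g 0, by simpa [lim] using (hzg 0 (by omega)).2, g 1, by simpa [lim] using (hzg 1 (by omega)).2,
      g 2, by simpa [lim] using (hzg 2 (by omega)).2, ?_⟩
    convert hf using 1
    refine (congrArg (fun c => attempt C F m v₀ c _ _) ?_).trans (attempt_congr fun a ha => ?_)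
    · simp
    · interval_cases a <;> simp

/-- Extend the colouring in the output array to the vertex `v₀`. -/
def extendCmd : Cmd :=
  .seq (copyCmd 1 0) (.seq (put 1 1 (.num 3)) (.seq (.assign 6 (.num 0)) searchCmd))

/-- Success is sound because attempts are checked. After a failed search, a feasible `φ` would give
a `Guide`, and `Guide.exists_attempt` would supply guesses that succeed. -/
theorem Env.sat_extendCmd (h : Env n m v₀ C A s) (hsymm : ∀ u < n, ∀ w < n, C u w = C w u)
    (hlt : ∀ u < n, ∀ w < n, C u w < 3)
    (hA : ∀ u < m, ∀ w < m, u ≠ v₀ → w ≠ v₀ → u ≠ w → ¬ (A 0 u = C u w ∧ A 0 w = C u w))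
    (hA3 : ∀ v < m, v ≠ v₀ → A 0 v < 3) :
    extendCmd.Sat n s fun s' => ∃ A', Env n m v₀ C A' s' ∧
      ((s'.reg 6 ≠ 0 ∧ Feasible C m (A' 0) ∧ ∀ v < m, A' 0 v < 3) ∨
        (s'.reg 6 = 0 ∧ ¬ ∃ φ : ℕ → ℕ, (∀ v < m, φ v < 3) ∧ Feasible C m φ)) := by
  refine sat_seq ((h.sat_copyCmd (j := 1) (k := 0) (by omega) (by omega) (by omega)).mono
    fun s₁ h₁ => sat_seq ?_)
  refine (h₁.sat_put (j := 1) (u := 1) (e := .num 3) (by omega) (by rw [h₁.vertex]; exact h₁.lt)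
    (by simp [Ex.eval])).mono fun s₂ h₂ => sat_seq ?_
  rw [h₁.vertex] at h₂
  simp only [Ex.eval, Function.update_idem, Function.update_self] at h₂
  refine sat_assign (Base.num_lt (by simp [Ex.eval])) ?_
  set F := Function.update (A 0) v₀ 3 with hF
  have hFne : ∀ v, v ≠ v₀ → F v = A 0 v := fun v hv => Function.update_of_ne hv _ _
  have hF3 : ∀ v < m, v ≠ v₀ → F v < 3 := fun v hv hne => by rw [hFne v hne]; exact hA3 v hv hne
  have hInv : Inv n m v₀ C F (s₂.setReg 6 ((Ex.num 0).eval s₂)) :=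
    ⟨_, h₂.setReg _ (by omega), by simp, fun h => absurd (State.setReg_self _ _ _) h⟩
  refine (sat_searchCmd hF3 hInv).mono ?_
  rintro s₃ ⟨⟨A', hE, -, hA'⟩, hiff⟩
  refine ⟨A', hE, ?_⟩
  by_cases h6 : s₃.reg 6 = 0
  · refine .inr ⟨h6, ?_⟩
    rintro ⟨φ, hφ3, hφ⟩
    have G : Guide C F m v₀ φ :=
      { symm := fun u hu w hw => hsymm u (hu.trans_le h.le) w (hw.trans_le h.le)
        colour_lt := fun u hu w hw => hlt u (hu.trans_le h.le) w (hw.trans_le h.le)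
        v₀_lt := h.lt
        old_v₀ := Function.update_self _ _ _
        old := fun u hu w hw hu' hw' huw => by
          rw [hFne u hu', hFne w hw']; exact hA u hu w hw hu' hw' huw
        new_lt := hφ3
        new := hφ }
    obtain ⟨z, g, hzg, hf⟩ := G.exists_attempt hF3
    exact hiff.2 (.inr ⟨_, hφ3 v₀ h.lt, z, g, hzg, hf⟩) h6
  · exact .inl ⟨h6, hA' h6⟩

/-! ### The two main programs. -/

/-- Prepare the registers. -/
def setupCmd : Cmd :=
  .seq (.assign 3 (.op .mul (.var 0) (.var 0))) (.seq (.assign 4 (.op .add (.var 3) (.var 0)))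
    (.seq (.assign 5 (.op .add (.var 4) (.var 0))) (.seq (.assign 22 (.num 3))
      (.assign 23 (.num 2)))))

theorem sat_setupCmd (h0 : s.reg 0 = n) (hC : ∀ i < n, ∀ j < n, s.mem (i * n + j) = C i j)
    (hs : ∀ a, s.mem a ≤ 3) :
    setupCmd.Sat n s fun s' => Base n C s' ∧ s'.mem = s.mem ∧ s'.reg 1 = s.reg 1 := by
  refine sat_seq (sat_assign ?_ (sat_seq (sat_assign ?_ (sat_seq (sat_assign ?_
    (sat_seq (sat_assign ?_ (sat_assign ?_ ⟨⟨?_, ?_, ?_, ?_, hC, hs⟩, rfl, ?_⟩))))))))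
  · simp [Ex.eval, Op.eval, h0]; nlinarith
  · simp [Ex.eval, Op.eval, h0, State.setReg]; nlinarith
  · simp [Ex.eval, Op.eval, h0, State.setReg]; nlinarith
  · exact Base.num_lt (by simp [Ex.eval])
  · exact Base.num_lt (by simp [Ex.eval])
  · simp [State.setReg, h0]
  · intro j hj
    interval_cases j <;> simp [State.setReg, h0, Ex.eval, Op.eval]; ring
  · simp [State.setReg, Ex.eval]
  · simp [State.setReg, Ex.eval]
  · simp [State.setReg]

/-- Write the answer to register `0`. -/
def answerCmd : Cmd := .ite (.var 6) (.assign 0 (.num 1)) (.assign 0 (.num 0))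

/-- Register `0` says whether there is a feasible colouring, and if so the output is one. -/
def Solved (n : ℕ) (C : ℕ → ℕ → ℕ) (s : State) : Prop :=
  (s.reg 0 = 1 ∧ ∃ φ : ℕ → ℕ, (∀ v < n, φ v < 3) ∧ Feasible C n φ ∧
      ∀ v < n, s.mem (n * n + v) = φ v) ∨
    (s.reg 0 = 0 ∧ ¬ ∃ φ : ℕ → ℕ, (∀ v < n, φ v < 3) ∧ Feasible C n φ)

/-- The output array holds a feasible colouring of the vertices below `m`, or register `6` is zero
and there is no feasible colouring. -/
def Progress (n m : ℕ) (C : ℕ → ℕ → ℕ) (s : State) : Prop :=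
  (s.reg 6 ≠ 0 ∧ ∃ φ : ℕ → ℕ, (∀ v < m, φ v < 3) ∧ Feasible C m φ ∧
      ∀ v < m, s.mem (n * n + v) = φ v) ∨
    (s.reg 6 = 0 ∧ ¬ ∃ φ : ℕ → ℕ, (∀ v < n, φ v < 3) ∧ Feasible C n φ)

theorem sat_answerCmd (h : Progress n n C s) : answerCmd.Sat n s (Solved n C) := by
  refine sat_ite (fun c => ?_) fun c => ?_ <;>
    refine sat_assign (Base.num_lt (by simp [Ex.eval])) ?_ <;> rcases h with h | h
  · exact .inl ⟨State.setReg_self _ _ _, h.2⟩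
  · exact absurd h.1 c
  · exact absurd c h.1
  · exact .inr ⟨State.setReg_self _ _ _, h.2⟩

/-- Infeasibility on the first `m` vertices passes to all `n`, since feasible colourings restrict.
-/
theorem Env.sat_extendCmd_progress (h : Env n m v₀ C A s)
    (hsymm : ∀ u < n, ∀ w < n, C u w = C w u) (hlt : ∀ u < n, ∀ w < n, C u w < 3)
    (hA : ∀ u < m, ∀ w < m, u ≠ v₀ → w ≠ v₀ → u ≠ w → ¬ (A 0 u = C u w ∧ A 0 w = C u w))
    (hA3 : ∀ v < m, v ≠ v₀ → A 0 v < 3) :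
    extendCmd.Sat n s fun s' => Base n C s' ∧ Progress n m C s' := by
  refine (h.sat_extendCmd hsymm hlt hA hA3).mono ?_
  rintro s' ⟨A', hE, h' | h'⟩
  · exact ⟨hE.base, .inl ⟨h'.1, A' 0, h'.2.2, h'.2.1, fun v hv => by
      simpa using hE.array 0 (by omega) v hv⟩⟩
  · refine ⟨hE.base, .inr ⟨h'.1, fun ⟨φ, hφ, hf⟩ => h'.2 ⟨φ, ?_, ?_⟩⟩⟩
    · exact fun v hv => hφ v (hv.trans_le h.le)
    · exact fun u hu w hw => hf u (hu.trans_le h.le) w (hw.trans_le h.le)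

/-- The algorithm for extending a feasible colouring by one vertex. -/
def extensionCmd : Cmd := .seq setupCmd (.seq (.assign 2 (.var 0)) (.seq extendCmd answerCmd))

theorem lt_sq {x : ℕ} (hx : x ≤ n) : x < (n + 2) ^ 2 := by nlinarith

theorem Base.env (h : Base n C s) (hm : m ≤ n) (hv : v₀ < m) (h1 : s.reg 1 = v₀)
    (h2 : s.reg 2 = m) : Env n m v₀ C (fun j v => s.mem (n * n + j * n + v)) s where
  base := h
  le := hm
  lt := hv
  vertex := h1
  active := h2
  array _ _ _ _ := rfl

theorem sat_extensionCmd (h0 : s.reg 0 = n) (hC : ∀ i < n, ∀ j < n, s.mem (i * n + j) = C i j)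
    (hs : ∀ a, s.mem a ≤ 3) (h1 : s.reg 1 = v₀) (hv : v₀ < n)
    (hsymm : ∀ u < n, ∀ w < n, C u w = C w u) (hlt : ∀ u < n, ∀ w < n, C u w < 3)
    (hA : ∀ u < n, ∀ w < n, u ≠ v₀ → w ≠ v₀ → u ≠ w →
      ¬ (s.mem (n * n + u) = C u w ∧ s.mem (n * n + w) = C u w))
    (hA3 : ∀ v < n, s.mem (n * n + v) < 3) :
    extensionCmd.Sat n s (Solved n C) := by
  refine sat_seq ((sat_setupCmd h0 hC hs).mono fun s₁ ⟨hB, hm, hr⟩ => sat_seq ?_)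
  refine sat_assign (by simp only [Ex.eval, hB.size]; exact lt_sq le_rfl) (sat_seq ?_)
  have hE := (hB.setReg (r := 2) (s₁.reg 0) (by omega)).env (m := n) (v₀ := v₀) le_rfl hv
    (by rw [State.setReg_of_ne _ _ (by omega), hr, h1])
    (by rw [State.setReg_self, hB.size])
  refine (hE.sat_extendCmd_progress hsymm hlt ?_ ?_).mono fun s₂ h₂ => sat_answerCmd h₂.2
  · simpa [State.setReg, hm] using hA
  · intro v hv _
    simpa [State.setReg, hm] using hA3 v hv

/-- The algorithm for the 3-compatible colouring problem. -/
def colouringCmd : Cmd :=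
  .seq setupCmd (.seq (.assign 6 (.num 1)) (.seq
    (.loop 1 21 0 (whenNe (.var 6) (.num 0) (.seq (.assign 1 (.var 21))
      (.seq (.assign 2 (.op .add (.var 21) (.num 1))) extendCmd)))) answerCmd))

theorem Progress.setReg (h : Progress n m C s) {r : ℕ} (x : ℕ) (hr : r ≠ 6) :
    Progress n m C (s.setReg r x) := by
  unfold Progress
  rwa [State.setReg_of_ne _ _ hr.symm]

theorem sat_colouringCmd (h0 : s.reg 0 = n) (hC : ∀ i < n, ∀ j < n, s.mem (i * n + j) = C i j)
    (hs : ∀ a, s.mem a ≤ 3)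
    (hsymm : ∀ u < n, ∀ w < n, C u w = C w u) (hlt : ∀ u < n, ∀ w < n, C u w < 3) :
    colouringCmd.Sat n s (Solved n C) := by
  refine sat_seq ((sat_setupCmd h0 hC hs).mono fun s₁ ⟨hB, _, _⟩ => sat_seq ?_)
  refine sat_assign (Base.num_lt (by simp [Ex.eval])) (sat_seq ?_)
  refine sat_loop (fun i s' => Base n C s' ∧ Progress n i C s') ?_ ⟨?_, ?_⟩ ?_ ?_
  · rw [State.setReg_of_ne _ _ (by omega), hB.size, pow_one]; omega
  · exact (hB.setReg _ (by omega)).setReg _ (by omega)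
  -- The iteration starts from the colouring of no vertices.
  · refine .inl ⟨?_, fun _ => 0, by omega, fun u hu => by omega, by omega⟩
    rw [State.setReg_of_ne _ _ (by omega), State.setReg_self]
    exact one_ne_zero
  · rintro i hi s₂ hi₂ - ⟨hB₂, hP⟩
    rw [State.setReg_of_ne _ _ (by omega), hB.size] at hi
    refine sat_whenNe (fun c => sat_seq ?_) fun c => ?_
    · simp only [Ex.eval] at c
      obtain ⟨-, φ, hφ, hf, hmem⟩ := hP.resolve_right fun h => c h.1
      refine sat_assign (by simp only [Ex.eval, hi₂]; exact lt_sq hi.le) (sat_seq ?_)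
      set s₃ := s₂.setReg 1 ((Ex.var 21).eval s₂)
      have hev : (Ex.op .add (.var 21) (.num 1)).eval s₃ = i + 1 := by
        simp [Ex.eval, Op.eval, s₃, State.setReg, hi₂]
      refine sat_assign (by rw [hev]; exact lt_sq hi) ?_
      rw [hev]
      have hE := ((hB₂.setReg (r := 1) (s₂.reg 21) (by omega)).setReg (r := 2) (i + 1)
        (by omega)).env (m := i + 1) (v₀ := i) hi (by omega)
        (by rw [State.setReg_of_ne _ _ (by omega), State.setReg_self, hi₂])
        (State.setReg_self _ _ _)
      refine (hE.sat_extendCmd_progress hsymm hlt ?_ ?_).mono fun s₄ h₄ =>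
        ⟨h₄.1.setReg _ (by omega), h₄.2.setReg _ (by omega)⟩
      · intro u hu w hw hu' hw' huw
        simp only [State.setReg, zero_mul, add_zero]
        rw [hmem u (by omega), hmem w (by omega)]
        exact hf u (by omega) w (by omega) huw
      · intro v hv hv'
        simp only [State.setReg, zero_mul, add_zero]
        rw [hmem v (by omega)]
        exact hφ v (by omega)
    · simp only [Ex.eval] at c
      exact ⟨hB₂.setReg _ (by omega),
        .inr (by simpa [State.setReg] using hP.resolve_left fun h => h.1 c)⟩
  · rintro s₂ - ⟨-, hP⟩
    rw [State.setReg_of_ne _ _ (by omega), hB.size] at hP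
    exact sat_answerCmd hP

end Extend

/-! ### Instances as inputs -/

namespace Extend

open RAM RAM.Cmd

variable {n : ℕ}

theorem colourEntry_lt {k : ℕ} (C : EdgeColouring (Fin n) (k + 1)) (i j : ℕ) :
    colourEntry C i j < k + 1 := by
  unfold colourEntry
  split_ifs
  · exact Fin.is_lt _
  · omega

theorem colourEntry_comm {k : ℕ} (C : EdgeColouring (Fin n) k) (i j : ℕ) :
    colourEntry C i j = colourEntry C j i := by
  unfold colourEntry
  by_cases h : i < n ∧ j < n ∧ i ≠ j
  · rw [dif_pos h, dif_pos ⟨h.2.1, h.1, h.2.2.symm⟩]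
    unfold EdgeColouring.colour
    congr 3
    exact Sym2.eq_swap
  · rw [dif_neg h, dif_neg fun h' => h ⟨h'.2.1, h'.1, h'.2.2.symm⟩]

theorem colourEntry_coe {k : ℕ} (C : EdgeColouring (Fin n) k) {u v : Fin n} (h : u ≠ v) :
    colourEntry C u v = C.colour u v h := by
  unfold colourEntry
  rw [dif_pos ⟨u.2, v.2, fun h' => h (Fin.ext h')⟩]

theorem compatible_iff {k : ℕ} {C : EdgeColouring (Fin n) k} {φ : Fin n → Fin k} {ψ : ℕ → ℕ}
    (h : ∀ v : Fin n, ψ v = φ v) : Compatible C φ ↔ Feasible (colourEntry C) n ψ := by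
  constructor
  · intro hc u hu w hw huw ⟨h1, h2⟩
    have hne : (⟨u, hu⟩ : Fin n) ≠ ⟨w, hw⟩ := by simpa using huw
    have e := colourEntry_coe C hne
    simp only at e
    rw [e] at h1 h2
    rcases hc _ _ hne with h' | h'
    · exact h' (Fin.ext ((h ⟨u, hu⟩).symm.trans h1))
    · exact h' (Fin.ext ((h ⟨w, hw⟩).symm.trans h2))
  · intro hf u v huv
    by_contra hc
    push Not at hc
    refine hf u u.2 v v.2 (fun h' => huv (Fin.ext h')) ⟨?_, ?_⟩
    · rw [h, hc.1, colourEntry_coe C huv]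
    · rw [h, hc.2, colourEntry_coe C huv]

theorem isAnswer_of_solved {C : EdgeColouring (Fin n) 3} {s σ : State}
    (h : Solved n (colourEntry C) s) (h0 : σ.reg 0 = s.reg 0) (hm : σ.mem = s.mem) :
    IsAnswer C σ := by
  unfold IsAnswer
  rw [h0, hm]
  rcases h with ⟨h1, ψ, hψ, hf, hmem⟩ | ⟨h1, h⟩
  · exact .inl ⟨h1, fun v => ⟨ψ v, hψ v v.2⟩, (compatible_iff fun _ => rfl).2 hf,
      fun v => hmem v v.2⟩
  · refine .inr ⟨h1, fun ⟨φ, hφ⟩ => h ⟨fun v => if h : v < n then φ ⟨v, h⟩ else 0, ?_, ?_⟩⟩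
    · intro v hv
      simp [hv]
    · exact (compatible_iff fun v => by simp).1 hφ

theorem Cmd.exec_of_sat {c : Cmd} (hwf : c.wf 24 = true) {C : EdgeColouring (Fin n) 3} {s : State}
    (hr : ∀ r, s.reg r ≤ n) (hs : ∀ a, s.mem a ≤ 3)
    (h : c.Sat n s (Solved n (colourEntry C))) :
    ∃ (t : ℕ) (σ : State), Exec ((n + 2) ^ (2 * c.width)) (c.code 24) s t σ ∧
      t ≤ c.coeff * (n + 1) ^ c.deg ∧ IsAnswer C σ := by
  -- Stored values stay below `(n + 2) ^ 2`; the power `c.width` of this bound leaves room for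
  -- intermediate results.
  obtain ⟨t, σ, hx, ht, ha, -⟩ := exec_code (K := 24) (M := (n + 2) ^ 2)
    (Base.num_lt (n := n) (x := 3) le_rfl) c hwf (W := (n + 2) ^ (2 * c.width))
    (by rw [pow_mul]) (s := s) (σ := s)
    ⟨fun r _ => lt_sq (hr r), fun a => Base.num_lt (hs a)⟩ ⟨rfl, fun _ _ => rfl⟩ h.1
  exact ⟨t, σ, hx, ht, isAnswer_of_solved h.2 (ha.2 0 (by omega)) ha.1⟩

theorem colourEntry_div_mod {C : EdgeColouring (Fin n) 3} {i j : ℕ} (hj : j < n) :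
    colourEntry C ((i * n + j) / n) ((i * n + j) % n) = colourEntry C i j := by
  rw [mul_comm, Nat.mul_add_div (by omega), Nat.div_eq_of_lt hj, Nat.mul_add_mod,
    Nat.mod_eq_of_lt hj, add_zero]

theorem exec_extension (C : EdgeColouring (Fin n) 3) (v₀ : Fin n) (φ₀ : Fin n → Fin 3)
    (h : CompatibleOn C {v₀}ᶜ φ₀) :
    ∃ (t : ℕ) (σ : State), Exec ((n + 2) ^ (2 * extensionCmd.width)) (extensionCmd.code 24)
      (extensionInput C v₀ φ₀) t σ ∧ t ≤ extensionCmd.coeff * (n + 1) ^ 6 ∧ IsAnswer C σ := by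
  have hmem : ∀ v (hv : v < n), (extensionInput C v₀ φ₀).mem (n * n + v) = φ₀ ⟨v, hv⟩ := by
    intro v hv
    simp [extensionInput, hv]
  -- The exponent `6` is `extensionCmd.deg` by evaluation: three loops over guessed vertices, the
  -- rounds, the vertices of a round, and the scan for a forbidding vertex.
  refine Cmd.exec_of_sat rfl (fun r => ?_) (fun a => ?_) (sat_extensionCmd (v₀ := v₀) rfl ?_
    (fun a => ?_) rfl v₀.2 (fun u _ w _ => colourEntry_comm C u w)
    (fun u _ w _ => colourEntry_lt C u w) ?_ ?_)
  · have := v₀.2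
    simp only [extensionInput]
    split_ifs <;> omega
  · simp only [extensionInput]
    split_ifs
    · exact (Fin.is_lt _).le
    · exact (colourEntry_lt C _ _).le
  · intro i hi j hj
    have : i * n + n ≤ n * n := by
      rw [← Nat.succ_mul]; exact Nat.mul_le_mul_right n hi
    simp only [extensionInput]
    rw [dif_neg (by omega), colourEntry_div_mod hj]
  · simp only [extensionInput]
    split_ifs
    · exact (Fin.is_lt _).le
    · exact (colourEntry_lt C _ _).le
  · intro u hu w hw hu' hw' huw ⟨h1, h2⟩
    have hne : (⟨u, hu⟩ : Fin n) ≠ ⟨w, hw⟩ := by simpa using huw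
    have e := colourEntry_coe C hne
    simp only at e
    rw [hmem u hu, e] at h1
    rw [hmem w hw, e] at h2
    rcases h _ _ hne (fun h' => hu' (congrArg Fin.val h')) (fun h' => hw' (congrArg Fin.val h'))
      with h' | h'
    · exact h' (Fin.ext h1)
    · exact h' (Fin.ext h2)
  · intro v hv
    rw [hmem v hv]
    exact Fin.is_lt _

theorem exec_colouring (C : EdgeColouring (Fin n) 3) :
    ∃ (t : ℕ) (σ : State), Exec ((n + 2) ^ (2 * colouringCmd.width)) (colouringCmd.code 24)
      (instanceInput C) t σ ∧ t ≤ colouringCmd.coeff * (n + 1) ^ 7 ∧ IsAnswer C σ := by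
  -- The loop over the vertices to be added raises the degree to `7`.
  refine Cmd.exec_of_sat rfl (fun r => ?_) (fun a => (colourEntry_lt C _ _).le)
    (sat_colouringCmd rfl (fun i _ j hj => colourEntry_div_mod hj)
    (fun a => (colourEntry_lt C _ _).le) (fun u _ w _ => colourEntry_comm C u w)
    (fun u _ w _ => colourEntry_lt C u w))
  simp only [instanceInput]
  split_ifs <;> omega

/-! ### Asymptotic estimates. -/

theorem isBigO_mul_succ_pow (K d : ℕ) :
    (fun n : ℕ => ((K * (n + 1) ^ d : ℕ) : ℝ)) =O[atTop] (fun n : ℕ => (n : ℝ) ^ d) := by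
  -- For `n ≥ 1` one has `n + 1 ≤ 2 * n`.
  refine .of_bound (K * 2 ^ d) (eventually_atTop.2 ⟨1, fun n hn => ?_⟩)
  rw [Real.norm_of_nonneg (by positivity), Real.norm_of_nonneg (by positivity), mul_assoc,
    ← mul_pow]
  push_cast
  have : (1 : ℝ) ≤ n := by exact_mod_cast hn
  gcongr
  linarith

theorem isBigO_pow_instanceSize :
    (fun n : ℕ => (n : ℝ) ^ 7) =O[atTop] (fun n : ℕ => (instanceSize n : ℝ) ^ (3.5 : ℝ)) := by
  -- Raise `n ^ 2 ≤ 2 * instanceSize n` to the power `3.5`.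
  refine .of_bound (2 ^ (3.5 : ℝ)) (Eventually.of_forall fun n => ?_)
  have h : (n : ℝ) ^ 2 ≤ 2 * instanceSize n := by
    simp only [instanceSize]
    push_cast
    rw [Nat.cast_choose_two]
    nlinarith [(Nat.cast_nonneg n : (0 : ℝ) ≤ n)]
  rw [Real.norm_of_nonneg (by positivity), Real.norm_of_nonneg (by positivity),
    ← Real.mul_rpow (by positivity) (by positivity)]
  calc (n : ℝ) ^ 7 = ((n : ℝ) ^ 2) ^ (3.5 : ℝ) := by
        rw [← Real.rpow_natCast (n : ℝ) 2, ← Real.rpow_mul (by positivity),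
          ← Real.rpow_natCast]
        norm_num
    _ ≤ _ := Real.rpow_le_rpow (by positivity) h (by norm_num)

end Extend

theorem mainTheorem1 :
    (∃ (P : RAM.Prog) (c : ℕ) (T : ℕ → ℕ),
      (fun n : ℕ => (T n : ℝ)) =O[atTop] (fun n : ℕ => (n : ℝ) ^ 6) ∧
      ∀ (n : ℕ) (C : EdgeColouring (Fin n) 3) (v₀ : Fin n) (φ₀ : Fin n → Fin 3),
        CompatibleOn C {v₀}ᶜ φ₀ →
        ∃ (t : ℕ) (s : RAM.State),
          RAM.Exec ((n + 2) ^ c) P (extensionInput C v₀ φ₀) t s ∧ t ≤ T n ∧ IsAnswer C s) ∧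
    (∃ (P : RAM.Prog) (c : ℕ) (T : ℕ → ℕ),
      (fun n : ℕ => (T n : ℝ)) =O[atTop] (fun n : ℕ => (n : ℝ) ^ 7) ∧
      (fun n : ℕ => (T n : ℝ)) =O[atTop] (fun n : ℕ => (instanceSize n : ℝ) ^ (3.5 : ℝ)) ∧
      ∀ (n : ℕ) (C : EdgeColouring (Fin n) 3),
        ∃ (t : ℕ) (s : RAM.State),
          RAM.Exec ((n + 2) ^ c) P (instanceInput C) t s ∧ t ≤ T n ∧ IsAnswer C s) := by
  refine ⟨⟨Extend.extensionCmd.code 24, _, _, Extend.isBigO_mul_succ_pow _ _,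
    fun _ => Extend.exec_extension⟩, Extend.colouringCmd.code 24, _, _,
    Extend.isBigO_mul_succ_pow _ _,
    (Extend.isBigO_mul_succ_pow _ _).trans Extend.isBigO_pow_instanceSize,
    fun _ => Extend.exec_colouring⟩
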